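/- Let $p$ be a prime, $\mathbb F_p=\mathbb Z/p$, and let $n\ge 0$ be an integer. A subspace of $\mathbb F_p^n$ is called unimodular if it is a direct summand of $\mathbb F_p^n$ (over a field, every subspace is). Let $X(\mathbb F_p^n)$ be the simplicial complex whose simplices are the sets $\{v_1,\dots,v_m\}\subset\mathbb F_p^n$ of $m$ distinct vectors whose span is a unimodular subspace of dimension $m$. Let $K(\mathbb F_p^n)$ be the simplicial complex whose vertices are the lines through the origin in $\mathbb F_p^n$ (unimodular subspaces of dimension $1$) and whose simplices are the sets $\{l_1,\dots,l_m\}$ of $m$ distinct lines which span a unimodular subspace of dimension $m$. An $i$-simplex is a simplex with $i+1$ elements, and the link of a simplex $\sigma$ in a complex $L$ is $\mathrm{link}_L\sigma=\{\tau : \sigma\cup\tau\in L,\ \sigma\cap\tau=\emptyset\}$. Homotopy equivalences refer to geometric realizations. A wedge of $0$ copies of a sphere $S^d$ with $d\ge 0$ is a point; $S^{-1}=\emptyset$, and a wedge of one copy of $S^{-1}$ is $\emptyset$. Then: (a) $K(\mathbb F_p^n)$ is homotopy equivalent to the wedge of $A_n(p)$ spheres $S^{n-1}$, where $$A_n(p)=(-1)^n+\sum_{i=0}^{n-1}(-1)^{n-1-i}\,\frac{(p^n-p^i)\cdots(p^n-p^0)}{(p-1)^{i+1}\,(i+1)!}.$$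 (b) For every $i\geq 0$, the link of every $i$-simplex of $K(\mathbb F_p^n)$ is homotopy equivalent to the wedge of $A_{i,n}(p)$ spheres $S^{n-i-2}$, where $$A_{i,n}(p)=(-1)^{n-i-1}+\sum_{k=0}^{n-i-2}(-1)^{n-i-2-k}\,\frac{(p^n-p^{i+1})\cdots(p^n-p^{i+k+1})}{(p-1)^{k+1}\,(k+1)!}.$$ (c) $X(\mathbb F_p^n)$ is homotopy equivalent to the wedge of $B_n(p)$ spheres $S^{n-1}$, where $$B_n(p)=(-1)^n+\sum_{i=0}^{n-1}(-1)^{n-1-i}\,\frac{(p^n-p^i)\cdots(p^n-p^0)}{(i+1)!}.$$ (d) For every $i\geq 0$, the link of every $i$-simplex of $X(\mathbb F_p^n)$ is homotopy equivalent to the wedge of $B_{i,n}(p)$ spheres $S^{n-i-2}$, where $$B_{i,n}(p)=(-1)^{n-i-1}+\sum_{k=0}^{n-i-2}(-1)^{n-i-2-k}\,\frac{(p^n-p^{i+1})\cdots(p^n-p^{i+k+1})}{(k+1)!}.$$ In particular these four numbers are nonnegative integers. -/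

import Mathlib

/-- `W` is a unimodular subspace of dimension `m`: a direct summand of rank `m`. -/
def IsUnimodularSubspace {k V : Type*} [Field k] [AddCommGroup V] [Module k V]
    (W : Submodule k V) (m : ℕ) : Prop :=
  IsComplemented W ∧ Module.finrank k W = m

/-- A finite set of vectors is unimodular if its span is a direct summand whose dimension is the
number of vectors. -/
def IsUnimodularSet (k : Type*) {V : Type*} [Field k] [AddCommGroup V] [Module k V]
    (s : Finset V) : Prop :=
  IsUnimodularSubspace (Submodule.span k (s : Set V)) s.card

theorem isUnimodularSet_iff_linearIndependent {k V : Type*} [Field k] [AddCommGroup V]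
    [Module k V] (s : Finset V) :
    IsUnimodularSet k s ↔ LinearIndependent k (fun x : s => (x : V)) := by
  have hr : Set.range (fun x : s => (x : V)) = (s : Set V) := by ext; simp
  rw [linearIndependent_iff_card_eq_finrank_span, hr, Fintype.card_coe]
  exact ⟨fun h => h.2.symm, fun h => ⟨exists_isCompl _, h.symm⟩⟩

theorem IsUnimodularSet.subset {k V : Type*} [Field k] [AddCommGroup V] [Module k V]
    {s t : Finset V} (hs : IsUnimodularSet k s) (h : t ⊆ s) : IsUnimodularSet k t := by
  rw [isUnimodularSet_iff_linearIndependent] at hs ⊢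
  exact hs.comp (fun x : t => (⟨x.1, h x.2⟩ : s)) (fun a b hab => by
    exact Subtype.ext (congrArg (fun z : s => (z : V)) hab))

theorem finrank_sup_lines_le {k V : Type*} [Field k] [AddCommGroup V] [Module k V]
    [FiniteDimensional k V] (s : Finset (Submodule k V))
    (hs : ∀ l ∈ s, Module.finrank k l = 1) :
    Module.finrank k (s.sup id : Submodule k V) ≤ s.card := by
  classical
  induction s using Finset.induction_on with
  | empty => simp
  | insert a s ha ih =>
    rw [Finset.sup_insert, Finset.card_insert_of_notMem ha]
    have h1 := Submodule.finrank_add_le_finrank_add_finrank (id a) (s.sup id)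
    have h2 := ih (fun l hl => hs l (Finset.mem_insert_of_mem hl))
    have h3 : Module.finrank k (id a : Submodule k V) = 1 := hs a (Finset.mem_insert_self _ _)
    omega

/-- The complex `X(kⁿ)`: its simplices are the nonempty unimodular subsets of `kⁿ`. -/
def complexX (k : Type*) [Field k] (n : ℕ) : PreAbstractSimplicialComplex (Fin n → k) where
  faces := {s | s.Nonempty ∧ IsUnimodularSet k s}
  isRelLowerSet_faces := by
    intro s hs
    exact ⟨hs.1, fun t hts ht => ⟨ht, hs.2.subset hts⟩⟩

/-- The complex `K(kⁿ)`: its simplices are the nonempty finite sets of lines through the origin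
(unimodular subspaces of dimension one) which span a unimodular subspace whose dimension is the
number of lines. -/
def complexK (k : Type*) [Field k] (n : ℕ) :
    PreAbstractSimplicialComplex (Submodule k (Fin n → k)) where
  faces := {s | s.Nonempty ∧ (∀ l ∈ s, IsUnimodularSubspace l 1) ∧
    IsUnimodularSubspace (s.sup id) s.card}
  isRelLowerSet_faces := by
    classical
    intro s hs
    refine ⟨hs.1, fun t hts ht => ⟨ht, fun l hl => hs.2.1 l (hts hl), exists_isCompl _, ?_⟩⟩
    have hts' : t ⊆ s := hts
    have h1 := finrank_sup_lines_le t (fun l hl => (hs.2.1 l (hts hl)).2)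
    have h2 := finrank_sup_lines_le (s \ t)
      (fun l hl => (hs.2.1 l (Finset.sdiff_subset hl)).2)
    have h3 := Submodule.finrank_add_le_finrank_add_finrank (t.sup id) ((s \ t).sup id)
    rw [← Finset.sup_union, Finset.union_sdiff_of_subset hts', hs.2.2.2] at h3
    have h4 := Finset.card_sdiff_add_card_eq_card hts'
    omega

open Classical in
/-- The link of `σ` in `K`: the (nonempty) `τ` disjoint from `σ` such that `σ ∪ τ` is a simplex. -/
def simplicialLink {V : Type*} (K : PreAbstractSimplicialComplex V) (σ : Finset V) :
    PreAbstractSimplicialComplex V where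
  faces := {τ | τ.Nonempty ∧ σ ∪ τ ∈ K.faces ∧ Disjoint σ τ}
  isRelLowerSet_faces := by
    intro τ hτ
    refine ⟨hτ.1, fun ρ hρ hne => ⟨hne, ?_, hτ.2.2.mono_right hρ⟩⟩
    exact (K.isRelLowerSet_faces hτ.2.1).2 (Finset.union_subset_union_right hρ)
      (hne.mono Finset.subset_union_right)

/-- The geometric realization of a simplicial complex on a finite vertex type, in barycentric
coordinates: the nonnegative functions on the vertices that have sum one and vanish outside some
simplex, with the topology induced from `V → ℝ`. -/
def realization {V : Type*} [Finite V] (K : PreAbstractSimplicialComplex V) : Set (V → ℝ) :=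
  {t | (∀ v, 0 ≤ t v) ∧ ∃ s ∈ K.faces, (∀ v, v ∉ s → t v = 0) ∧ ∑ v ∈ s, t v = 1}

/-- The relation on `{*} ⊔ ⨆ᵢ Xᵢ` which identifies every base point with the extra point `*`. -/
inductive WedgeRel {ι : Type*} (X : ι → Type*) (x₀ : ∀ i, X i) :
    Unit ⊕ (Σ i, X i) → Unit ⊕ (Σ i, X i) → Prop
  | glue (i : ι) : WedgeRel X x₀ (Sum.inl ()) (Sum.inr ⟨i, x₀ i⟩)

/-- The wedge of a family of pointed spaces, with the quotient topology. It is a point if the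
family is empty. -/
def Wedge {ι : Type*} (X : ι → Type*) (x₀ : ∀ i, X i) : Type _ := Quot (WedgeRel X x₀)

instance {ι : Type*} (X : ι → Type*) (x₀ : ∀ i, X i) [∀ i, TopologicalSpace (X i)] :
    TopologicalSpace (Wedge X x₀) :=
  inferInstanceAs (TopologicalSpace (Quot (WedgeRel X x₀)))

/-- The unit sphere `S^d` in `ℝ^(d+1)`. -/
abbrev UnitSphere (d : ℕ) : Type := Metric.sphere (0 : EuclideanSpace ℝ (Fin (d + 1))) 1

/-- The base point `(1, 0, …, 0)` of `S^d`. -/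
noncomputable def sphereBase (d : ℕ) : UnitSphere d :=
  ⟨EuclideanSpace.single 0 1, by simp⟩

/-- The wedge of `N` copies of `S^d`. -/
abbrev SphereWedge (N d : ℕ) : Type :=
  Wedge (fun _ : Fin N => UnitSphere d) (fun _ => sphereBase d)

/-- `Y` is homotopy equivalent to the wedge of `N` copies of `S^d`, where `d ≥ -1`. For `d = -1`
the convention is that `S^(-1)` is empty, and the only wedge of copies of it is that of a single
one, which is empty. -/
def IsHomotopyWedgeOfSpheres (Y : Type*) [TopologicalSpace Y] (N : ℕ) (d : ℤ) : Prop :=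
  (d = -1 ∧ N = 1 ∧ IsEmpty Y) ∨
    ∃ m : ℕ, d = m ∧ Nonempty (ContinuousMap.HomotopyEquiv Y (SphereWedge N m))

/-- The number `A_n(p)`. -/
def numA (n p : ℕ) : ℚ :=
  (-1) ^ n + ∑ i ∈ Finset.range n, (-1) ^ (n - 1 - i) *
    ((∏ j ∈ Finset.range (i + 1), ((p : ℚ) ^ n - (p : ℚ) ^ j)) /
      (((p : ℚ) - 1) ^ (i + 1) * ((i + 1).factorial : ℚ)))

/-- The number `A_{i,n}(p)`. -/
def numALink (i n p : ℕ) : ℚ :=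
  (-1) ^ (n - i - 1) + ∑ k ∈ Finset.range (n - i - 1), (-1) ^ (n - i - 2 - k) *
    ((∏ j ∈ Finset.range (k + 1), ((p : ℚ) ^ n - (p : ℚ) ^ (i + 1 + j))) /
      (((p : ℚ) - 1) ^ (k + 1) * ((k + 1).factorial : ℚ)))

/-- The number `B_n(p)`. -/
def numB (n p : ℕ) : ℚ :=
  (-1) ^ n + ∑ i ∈ Finset.range n, (-1) ^ (n - 1 - i) *
    ((∏ j ∈ Finset.range (i + 1), ((p : ℚ) ^ n - (p : ℚ) ^ j)) / ((i + 1).factorial : ℚ))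

/-- The number `B_{i,n}(p)`. -/
def numBLink (i n p : ℕ) : ℚ :=
  (-1) ^ (n - i - 1) + ∑ k ∈ Finset.range (n - i - 1), (-1) ^ (n - i - 2 - k) *
    ((∏ j ∈ Finset.range (k + 1), ((p : ℚ) ^ n - (p : ℚ) ^ (i + 1 + j))) /
      ((k + 1).factorial : ℚ))

/-! Both complexes are independence complexes of matroids. For `X` the ground set consists of all
vectors, with the zero vector as a loop; for `K` it consists of all subspaces, those of dimension
other than one being loops. A link is the independence complex of a contraction. So (a)-(d) all
follow from one fact about matroids together with a count of independent sets.

The fact: in a matroid of rank `r > 0` some set `B` of bases can be removed from the independence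
complex so that the rest is collapsible (`IsIndepFamily.exists_collapsible_sdiff`, by deletion and
contraction of an element). The rest is then contractible, and shrinking it to a point leaves one
`(r-1)`-sphere for each removed open simplex (`nonempty_homotopyEquiv_sphereWedge`). Everything is
done by hand in barycentric coordinates: an elementary expansion is a deformation retraction, the
contraction of the subcomplex is extended to the whole complex, and each open top simplex is
identified with Euclidean space.

The number of spheres is forced by the Euler characteristic, since a collapsible complex has that of
a point. Over a field with `q` elements the number of ways to enlarge an independent set depends
only on its cardinality `j`: it is `q^n - q^j` for vectors, and this divided by `q - 1` for lines.
Double counting turns this into the products over factorials in the four formulas. -/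

/-! ### Collapsible complexes and independence complexes of matroids. -/

section Combinatorics

variable {V : Type*} [DecidableEq V]

/-- A finite family of nonempty finite sets is collapsible if it is obtained from a single vertex
by successive elementary expansions: adding a simplex `insert v σ` together with its facet `σ`. -/
inductive Collapsible : Finset (Finset V) → Prop
  | vertex (v : V) : Collapsible {{v}}
  | expand {F : Finset (Finset V)} {σ : Finset V} {v : V} : Collapsible F → σ.Nonempty → v ∉ σ →
      σ ∉ F → (∀ ρ ⊆ insert v σ, ρ.Nonempty → ρ ≠ σ → ρ ≠ insert v σ → ρ ∈ F) →
      Collapsible (insert σ (insert (insert v σ) F))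

namespace Collapsible

theorem of_eq {F G : Finset (Finset V)} {σ : Finset V} {v : V} (hF : Collapsible F)
    (hσ : σ.Nonempty) (hv : v ∉ σ) (hσF : σ ∉ F)
    (h : ∀ ρ ⊆ insert v σ, ρ.Nonempty → ρ ≠ σ → ρ ≠ insert v σ → ρ ∈ F)
    (hG : G = insert σ (insert (insert v σ) F)) : Collapsible G :=
  hG ▸ hF.expand hσ hv hσF h

theorem isRelLowerSet {F : Finset (Finset V)} (hF : Collapsible F) :
    IsRelLowerSet (F : Set (Finset V)) Finset.Nonempty := by
  induction hF with
  | vertex v =>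
    intro s hs
    simp only [Finset.coe_singleton, Set.mem_singleton_iff] at hs
    subst hs
    refine ⟨Finset.singleton_nonempty v, fun t ht hne => ?_⟩
    simpa using (Finset.subset_singleton_iff.1 ht).resolve_left hne.ne_empty
  | @expand F σ v hF hσ hv hσF h ih =>
    have key : ∀ t ⊆ insert v σ, t.Nonempty → t ∈ insert σ (insert (insert v σ) F) := by
      intro t ht hne
      by_cases h1 : t = σ
      · simp [h1]
      by_cases h2 : t = insert v σ
      · simp [h2]
      simp [h t ht hne h1 h2]
    intro s hs
    simp only [Finset.coe_insert, Set.mem_insert_iff, Finset.mem_coe] at hs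
    rcases hs with rfl | rfl | hs
    · exact ⟨hσ, fun t ht hne => key t (ht.trans (Finset.subset_insert _ _)) hne⟩
    · exact ⟨Finset.insert_nonempty _ _, fun t ht hne => key t ht hne⟩
    · refine ⟨(ih hs).1, fun t ht hne => ?_⟩
      have := (ih hs).2 ht hne
      simp only [Finset.mem_coe] at this
      simp [this]

theorem insert_notMem {F : Finset (Finset V)} {σ : Finset V} {v : V} (hF : Collapsible F)
    (hσ : σ.Nonempty) (hσF : σ ∉ F) : insert v σ ∉ F := fun h =>
  hσF ((hF.isRelLowerSet h).2 (Finset.subset_insert v σ) hσ)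

/-- An elementary expansion adds two faces of opposite parity, so the alternating sum keeps the
value it has on a single vertex. -/
theorem sum_neg_one_pow_card {F : Finset (Finset V)} (hF : Collapsible F) :
    ∑ s ∈ F, (-1 : ℤ) ^ s.card = -1 := by
  induction hF with
  | vertex v => simp
  | @expand F σ v hF hσ hv hσF h ih =>
    have h1 := hF.insert_notMem (v := v) hσ hσF
    have h2 : σ ≠ insert v σ := fun h => hv (h ▸ Finset.mem_insert_self v σ)
    rw [Finset.sum_insert (by simp [h2, hσF]), Finset.sum_insert h1, ih,
      Finset.card_insert_of_notMem hv, pow_succ]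
    ring

/-- Induction on the number of faces of the base: for a face `σ` of largest cardinality, `σ` and
`insert e σ` are added last, and `σ` is then a free facet. An empty base leaves the apex alone. -/
theorem cone {F : Finset (Finset V)} (hF : IsRelLowerSet (F : Set (Finset V)) Finset.Nonempty)
    {e : V} (he : ∀ s ∈ F, e ∉ s) : Collapsible (F ∪ insert {e} (F.image (insert e))) := by
  induction hn : F.card generalizing F with
  | zero =>
    rw [Finset.card_eq_zero] at hn
    subst hn
    simpa using vertex e
  | succ n ih =>
    obtain ⟨σ, hσ, hmax⟩ := F.exists_max_image Finset.card (Finset.card_pos.1 (by omega))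
    have hlow : IsRelLowerSet ((F.erase σ : Finset _) : Set (Finset V)) Finset.Nonempty := by
      intro s hs
      simp only [Finset.coe_erase, Set.mem_sdiff, Finset.mem_coe, Set.mem_singleton_iff] at hs
      refine ⟨(hF hs.1).1, fun t ht hne => ?_⟩
      simp only [Finset.coe_erase, Set.mem_sdiff, Set.mem_singleton_iff]
      refine ⟨(hF hs.1).2 ht hne, ?_⟩
      rintro rfl
      exact hs.2 (Finset.eq_of_subset_of_card_le ht (hmax s hs.1)).symm
    have hσne := (hF hσ).1
    refine of_eq (ih hlow (fun s hs => he s (Finset.mem_of_mem_erase hs))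
      (by rw [Finset.card_erase_of_mem hσ]; omega)) hσne (he σ hσ) ?_ ?_ ?_ (σ := σ) (v := e)
    · simp only [Finset.mem_union, Finset.mem_erase, ne_eq, not_true_eq_false, false_and,
        Finset.mem_insert, Finset.mem_image, false_or, not_or, not_exists, not_and]
      refine ⟨fun h => he σ hσ (by simp [h]), fun a _ h => he σ hσ ?_⟩
      rw [← h]; exact Finset.mem_insert_self _ _
    · intro ρ hρ hne h1 h2
      by_cases heρ : e ∈ ρ
      · obtain ⟨τ, rfl, hτ⟩ : ∃ τ, ρ = insert e τ ∧ e ∉ τ :=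
          ⟨ρ.erase e, (Finset.insert_erase heρ).symm, Finset.notMem_erase e ρ⟩
        have hτσ : τ ⊆ σ := (Finset.insert_subset_insert_iff hτ).1 hρ
        rcases τ.eq_empty_or_nonempty with rfl | hτne
        · simp
        · refine Finset.mem_union_right _ (Finset.mem_insert_of_mem (Finset.mem_image_of_mem _ ?_))
          exact Finset.mem_erase.2 ⟨fun h => h2 (by rw [h]), (hF hσ).2 hτσ hτne⟩
      · have : ρ ⊆ σ := (Finset.subset_insert_iff_of_notMem heρ).1 hρ
        exact Finset.mem_union_left _ (Finset.mem_erase.2 ⟨h1, (hF hσ).2 this hne⟩)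
    · nth_rewrite 1 2 [← Finset.insert_erase hσ]
      rw [Finset.image_insert]
      ext s
      simp only [Finset.mem_union, Finset.mem_insert]
      tauto

/-- Coning replays the construction of `C`: an expansion by `σ` and `insert v σ` becomes the
expansion by the same two faces with `e` inserted. The initial vertex `w` of `C` becomes the
expansion that attaches the edge from `w` to the new vertex `e`. -/
theorem union_cone {F C : Finset (Finset V)} (hF : Collapsible F) (hC : Collapsible C)
    (hCF : C ⊆ F) {e : V} (he : ∀ s ∈ F, e ∉ s) :
    Collapsible (F ∪ insert {e} (C.image (insert e))) := by
  induction hC with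
  | vertex w =>
    have hw : {w} ∈ F := hCF (Finset.mem_singleton_self _)
    have hew : w ≠ e := fun h => he _ hw (by simp [h])
    refine of_eq hF (Finset.singleton_nonempty e) (v := w) (by simpa using hew)
      (fun h => he _ h (by simp)) ?_ ?_
    · intro ρ hρ hne h1 h2
      have heρ : e ∉ ρ := by
        intro heρ
        by_cases hwρ : w ∈ ρ
        · exact h2 (hρ.antisymm (by simp [Finset.insert_subset_iff, heρ, hwρ]))
        · exact h1 (Finset.Subset.antisymm ((Finset.subset_insert_iff_of_notMem hwρ).1 hρ)
            (by simpa using heρ))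
      have : ρ ⊆ {w} := by
        rw [Finset.pair_comm] at hρ
        exact (Finset.subset_insert_iff_of_notMem heρ).1 hρ
      rw [(Finset.subset_singleton_iff.1 this).resolve_left hne.ne_empty]
      exact hw
    · ext s
      simp only [Finset.image_singleton, Finset.mem_union, Finset.mem_insert,
        Finset.mem_singleton, Finset.pair_comm w e]
      tauto
  | @expand C σ v hC hσ hv hσC h ih =>
    have hCF' : C ⊆ F := fun s hs => hCF (by simp [hs])
    have hσF : σ ∈ F := hCF (by simp)
    have hτF : insert v σ ∈ F := hCF (by simp)
    have heσ := he _ hσF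
    have heτ := he _ hτF
    have hev : v ≠ e := fun h => heτ (by simp [h])
    refine of_eq (ih hCF') (Finset.insert_nonempty e σ) (v := v) (by simp [hev, hv]) ?_ ?_ ?_
    · simp only [Finset.mem_union, Finset.mem_insert, Finset.mem_image, not_or, not_exists, not_and]
      refine ⟨fun h => he _ h (by simp), fun h => ?_, fun s hs h => hσC ?_⟩
      · obtain ⟨x, hx⟩ := hσ
        have : x ∈ ({e} : Finset V) := h ▸ Finset.mem_insert_of_mem hx
        exact heσ (Finset.mem_singleton.1 this ▸ hx)
      · have hes := he s (hCF' hs)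
        rw [← Finset.erase_insert heσ, ← h, Finset.erase_insert hes]
        exact hs
    · intro ρ hρ hne h1 h2
      rw [Finset.insert_comm] at hρ h2
      by_cases heρ : e ∈ ρ
      · obtain ⟨τ, rfl, hτ⟩ : ∃ τ, ρ = insert e τ ∧ e ∉ τ :=
          ⟨ρ.erase e, (Finset.insert_erase heρ).symm, Finset.notMem_erase e ρ⟩
        have hτσ : τ ⊆ insert v σ := (Finset.insert_subset_insert_iff hτ).1 hρ
        rcases τ.eq_empty_or_nonempty with rfl | hτne
        · simp
        · refine Finset.mem_union_right _ (Finset.mem_insert_of_mem (Finset.mem_image_of_mem _ ?_))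
          exact h τ hτσ hτne (fun h => h1 (by rw [h])) (fun h => h2 (by rw [h]))
      · have : ρ ⊆ insert v σ := (Finset.subset_insert_iff_of_notMem heρ).1 hρ
        exact Finset.mem_union_left _ ((hF.isRelLowerSet hτF).2 this hne)
    · rw [Finset.image_insert, Finset.image_insert, Finset.insert_comm v e]
      ext s
      simp only [Finset.mem_union, Finset.mem_insert]
      tauto

end Collapsible

/-- The axioms of the family of independent sets of a matroid. -/
structure IsIndepFamily (I : Finset (Finset V)) : Prop where
  empty_mem : ∅ ∈ I
  subset_mem : ∀ {s t : Finset V}, s ∈ I → t ⊆ s → t ∈ I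
  exchange : ∀ {s t : Finset V}, s ∈ I → t ∈ I → s.card < t.card →
    ∃ x ∈ t, x ∉ s ∧ insert x s ∈ I

namespace IsIndepFamily

variable {I : Finset (Finset V)}

theorem isRelLowerSet (hI : IsIndepFamily I) :
    IsRelLowerSet ((I.erase ∅ : Finset _) : Set (Finset V)) Finset.Nonempty := by
  intro s hs
  simp only [Finset.coe_erase, Set.mem_sdiff, Finset.mem_coe, Set.mem_singleton_iff] at hs
  refine ⟨Finset.nonempty_iff_ne_empty.2 hs.2, fun t ht hne => ?_⟩
  simp only [Finset.coe_erase, Set.mem_sdiff, Finset.mem_coe, Set.mem_singleton_iff]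
  exact ⟨hI.subset_mem hs.1 ht, hne.ne_empty⟩

theorem deletion (hI : IsIndepFamily I) (e : V) : IsIndepFamily (I.filter (e ∉ ·)) where
  empty_mem := by simp [hI.empty_mem]
  subset_mem := by
    intro s t hs hts
    rw [Finset.mem_filter] at hs ⊢
    exact ⟨hI.subset_mem hs.1 hts, fun h => hs.2 (hts h)⟩
  exchange := by
    intro s t hs ht hst
    rw [Finset.mem_filter] at hs ht
    obtain ⟨x, hx, hxs, h⟩ := hI.exchange hs.1 ht.1 hst
    refine ⟨x, hx, hxs, Finset.mem_filter.2 ⟨h, ?_⟩⟩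
    rw [Finset.mem_insert, not_or]
    exact ⟨fun h => ht.2 (h ▸ hx), hs.2⟩

/-- Exchange is inherited by comparing `σ ∪ s` with `σ ∪ t`: the element found lies outside `σ`,
hence in `t`. -/
theorem link (hI : IsIndepFamily I) {σ : Finset V} (hσ : σ ∈ I) :
    IsIndepFamily (I.filter (fun s => Disjoint σ s ∧ σ ∪ s ∈ I)) where
  empty_mem := by simp [hI.empty_mem, hσ]
  subset_mem := by
    intro s t hs hts
    rw [Finset.mem_filter] at hs ⊢
    exact ⟨hI.subset_mem hs.1 hts, hs.2.1.mono_right hts,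
      hI.subset_mem hs.2.2 (Finset.union_subset_union_right hts)⟩
  exchange := by
    intro s t hs ht hst
    rw [Finset.mem_filter] at hs ht
    obtain ⟨x, hx, hxs, h⟩ := hI.exchange hs.2.2 ht.2.2
      (by rwa [Finset.card_union_of_disjoint hs.2.1, Finset.card_union_of_disjoint ht.2.1,
        Nat.add_lt_add_iff_left])
    rw [Finset.mem_union, not_or] at hxs
    have hxt := (Finset.mem_union.1 hx).resolve_left hxs.1
    rw [← Finset.union_insert] at h
    refine ⟨x, hxt, hxs.2, Finset.mem_filter.2
      ⟨hI.subset_mem h Finset.subset_union_right, ?_, h⟩⟩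
    exact Finset.disjoint_insert_right.2 ⟨hxs.1, hs.2.1⟩

theorem contraction (hI : IsIndepFamily I) {e : V} (he : {e} ∈ I) :
    IsIndepFamily (I.filter (fun s => e ∉ s ∧ insert e s ∈ I)) := by
  simpa only [Finset.disjoint_singleton_left, ← Finset.insert_eq] using hI.link he

theorem exists_superset_card_eq (hI : IsIndepFamily I) {s b : Finset V} (hs : s ∈ I) (hb : b ∈ I)
    {k : ℕ} (hk : s.card ≤ k) (hkb : k ≤ b.card) : ∃ t ∈ I, s ⊆ t ∧ t.card = k := by
  induction k, hk using Nat.le_induction with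
  | base => exact ⟨s, hs, subset_rfl, rfl⟩
  | succ k hk ih =>
    obtain ⟨t, ht, hst, htk⟩ := ih (by omega)
    obtain ⟨x, -, hxt, hx⟩ := hI.exchange ht hb (by omega)
    exact ⟨_, hx, hst.trans (Finset.subset_insert _ _),
      by rw [Finset.card_insert_of_notMem hxt, htk]⟩

/-- Deletion and contraction: the complex is the deletion `D` of `e` with a cone of apex `e`
attached along the contraction `C ⊆ D`. Bases `B` of `D` and `B'` of `C` are removed by induction,
and `B` together with the sets `insert e b`, `b ∈ B'`, is removed from the whole. The induction runs
over a finite set `E` containing all independent sets. -/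
theorem exists_collapsible_sdiff (hI : IsIndepFamily I) {r : ℕ} (hr : r ≠ 0)
    (hex : ∃ s ∈ I, s.card = r) (hmax : ∀ s ∈ I, s.card ≤ r) :
    ∃ B ⊆ I, (∀ s ∈ B, s.card = r) ∧ Collapsible (I.erase ∅ \ B) := by
  obtain ⟨E, hE⟩ : ∃ E : Finset V, ∀ s ∈ I, s ⊆ E :=
    ⟨I.sup id, fun s hs => Finset.le_sup (f := id) hs⟩
  induction E using Finset.induction_on generalizing I r with
  | empty =>
    obtain ⟨s, hs, rfl⟩ := hex
    exact absurd (Finset.card_eq_zero.2 (Finset.subset_empty.1 (hE s hs))) hr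
  | insert e E heE ih =>
    by_cases he : {e} ∈ I
    swap
    -- A loop lies in no independent set, so the ground set shrinks and the family stays the same.
    · refine ih hI hr hex hmax fun s hs =>
        (Finset.subset_insert_iff_of_notMem fun hes => he ?_).1 (hE s hs)
      exact hI.subset_mem hs (Finset.singleton_subset_iff.2 hes)
    have hD := hI.deletion e
    have hC := hI.contraction he
    set D := I.filter (e ∉ ·) with hDdef
    set C := I.filter (fun s => e ∉ s ∧ insert e s ∈ I) with hCdef
    have hsub : ∀ s ∈ D, s ⊆ E := fun s hs =>
      (Finset.subset_insert_iff_of_notMem (Finset.mem_filter.1 hs).2).1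
        (hE s (Finset.mem_filter.1 hs).1)
    have hCD : C ⊆ D := fun s hs => by
      rw [hCdef, Finset.mem_filter] at hs
      exact Finset.mem_filter.2 ⟨hs.1, hs.2.1⟩
    have hsplit : I.erase ∅ = D.erase ∅ ∪ insert {e} ((C.erase ∅).image (insert e)) := by
      ext s
      simp only [Finset.mem_union, Finset.mem_erase, Finset.mem_insert, Finset.mem_image, hDdef,
        hCdef, Finset.mem_filter]
      constructor
      · rintro ⟨hne, hs⟩
        by_cases hes : e ∈ s
        · right
          by_cases hs' : s = {e}
          · exact Or.inl hs'
          refine Or.inr ⟨s.erase e, ⟨fun h => ?_, hI.subset_mem hs (Finset.erase_subset _ _),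
            Finset.notMem_erase _ _, by rwa [Finset.insert_erase hes]⟩, Finset.insert_erase hes⟩
          rw [Finset.erase_eq_empty_iff] at h
          exact h.elim hne hs'
        · exact Or.inl ⟨hne, hs, hes⟩
      · rintro (⟨hne, hs, -⟩ | rfl | ⟨t, ⟨-, -, -, ht⟩, rfl⟩)
        · exact ⟨hne, hs⟩
        · exact ⟨Finset.singleton_ne_empty e, he⟩
        · exact ⟨Finset.insert_ne_empty _ _, ht⟩
    have heD : ∀ s ∈ D.erase ∅, e ∉ s := fun s hs =>
      (Finset.mem_filter.1 (Finset.mem_of_mem_erase hs)).2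
    by_cases hDr : ∃ s ∈ D, s.card = r
    swap
    -- Here `e` is a coloop: it lies in every base, so `C = D` and the whole complex is a cone.
    · refine ⟨∅, Finset.empty_subset _, by simp, ?_⟩
      have hCeq : C = D := by
        refine hCD.antisymm fun s hs => ?_
        have hs' := Finset.mem_filter.1 hs
        refine Finset.mem_filter.2 ⟨hs'.1, hs'.2, ?_⟩
        by_contra hcon
        obtain ⟨b, hb, hbr⟩ := hex
        obtain ⟨t, ht, hst, htr⟩ :=
          hI.exists_superset_card_eq hs'.1 hb (hbr ▸ hmax s hs'.1) le_rfl
        have het : e ∈ t := by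
          by_contra het
          exact hDr ⟨t, Finset.mem_filter.2 ⟨ht, het⟩, htr.trans hbr⟩
        exact hcon (hI.subset_mem ht (Finset.insert_subset het hst))
      rw [Finset.sdiff_empty, hsplit, hCeq]
      exact Collapsible.cone hD.isRelLowerSet heD
    · obtain ⟨B, hBD, hBr, hB⟩ := ih hD hr hDr
        (fun s hs => hmax s (Finset.mem_filter.1 hs).1) hsub
      have hBI : B ⊆ I := hBD.trans (Finset.filter_subset _ _)
      have hCcard : ∀ s ∈ C, s.card + 1 ≤ r := fun s hs => by
        have hs := (Finset.mem_filter.1 hs).2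
        rw [← Finset.card_insert_of_notMem hs.1]
        exact hmax _ hs.2
      by_cases hr1 : r = 1
      · subst hr1
        refine ⟨insert {e} B, Finset.insert_subset he hBI, ?_, ?_⟩
        · intro s hs
          rcases Finset.mem_insert.1 hs with rfl | hs
          · simp
          · exact hBr s hs
        · convert hB using 1
          have hC0 : C.erase ∅ = ∅ := by
            rw [Finset.eq_empty_iff_forall_notMem]
            intro s hs
            rw [Finset.mem_erase] at hs
            exact hs.1 (Finset.card_eq_zero.1 (by have := hCcard s hs.2; omega))
          rw [hsplit, hC0]
          ext s
          simp only [Finset.image_empty, Finset.mem_sdiff, Finset.mem_union,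
            Finset.mem_insert, Finset.mem_singleton, insert_empty_eq]
          constructor
          · tauto
          · rintro ⟨h1, h2⟩
            refine ⟨Or.inl h1, fun h => h.elim (fun h => heD s h1 (by simp [h])) h2⟩
      · have hCex : ∃ s ∈ C, s.card = r - 1 := by
          obtain ⟨b, hb, hbr⟩ := hDr
          obtain ⟨t, ht, het, htr⟩ := hI.exists_superset_card_eq he (Finset.mem_filter.1 hb).1
            (k := r) (by rw [Finset.card_singleton]; omega) hbr.ge
          rw [Finset.singleton_subset_iff] at het
          refine ⟨t.erase e, Finset.mem_filter.2 ⟨hI.subset_mem ht (Finset.erase_subset _ _),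
            Finset.notMem_erase _ _, by rwa [Finset.insert_erase het]⟩, ?_⟩
          rw [Finset.card_erase_of_mem het, htr]
        obtain ⟨B', hBC, hBr', hB'⟩ := ih hC (r := r - 1) (by omega) hCex
          (fun s hs => by have := hCcard s hs; omega) (fun s hs => hsub s (hCD hs))
        refine ⟨B ∪ B'.image (insert e), ?_, ?_, ?_⟩
        · refine Finset.union_subset hBI fun s hs => ?_
          obtain ⟨t, ht, rfl⟩ := Finset.mem_image.1 hs
          exact (Finset.mem_filter.1 (hBC ht)).2.2
        · intro s hs
          rcases Finset.mem_union.1 hs with hs | hs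
          · exact hBr s hs
          · obtain ⟨t, ht, rfl⟩ := Finset.mem_image.1 hs
            rw [Finset.card_insert_of_notMem (Finset.mem_filter.1 (hBC ht)).2.1, hBr' t ht]
            omega
        -- Members of `C` have fewer than `r` elements, so none of them was removed with `B`.
        · have hCB : C.erase ∅ \ B' ⊆ D.erase ∅ \ B := by
            intro s hs
            simp only [Finset.mem_sdiff, Finset.mem_erase] at hs ⊢
            refine ⟨⟨hs.1.1, hCD hs.1.2⟩, fun hsB => ?_⟩
            have h1 := hBr s hsB
            have h2 := hCcard s hs.1.2
            omega
          convert hB.union_cone hB' hCB (fun s hs => heD s (Finset.mem_sdiff.1 hs).1) using 1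
          have hinj : ∀ s ∈ C, ∀ t ∈ C, insert e s = insert e t → s = t := by
            intro s hs t ht hst
            rw [← Finset.erase_insert (Finset.mem_filter.1 hs).2.1, hst,
              Finset.erase_insert (Finset.mem_filter.1 ht).2.1]
          rw [hsplit]
          ext s
          simp only [Finset.mem_sdiff, Finset.mem_union, Finset.mem_insert, Finset.mem_image,
            not_or]
          constructor
          · rintro ⟨h1 | h1 | ⟨t, ht, rfl⟩, h2, h3⟩
            · exact Or.inl ⟨h1, h2⟩
            · exact Or.inr (Or.inl h1)
            · exact Or.inr (Or.inr ⟨t, ⟨ht, fun h => h3 ⟨t, h, rfl⟩⟩, rfl⟩)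
          · have hB1 : ∀ s, e ∈ s → s ∉ B := fun s hes h =>
              (Finset.mem_filter.1 (hBD h)).2 hes
            rintro (⟨h1, h2⟩ | rfl | ⟨t, ⟨ht, htB⟩, rfl⟩)
            · refine ⟨Or.inl h1, h2, ?_⟩
              rintro ⟨t, -, rfl⟩
              exact heD _ h1 (Finset.mem_insert_self _ _)
            · refine ⟨Or.inr (Or.inl rfl), hB1 _ (by simp), ?_⟩
              rintro ⟨t, ht, h⟩
              have h1 := congrArg Finset.card h
              rw [Finset.card_insert_of_notMem (Finset.mem_filter.1 (hBC ht)).2.1, hBr' t ht,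
                Finset.card_singleton] at h1
              omega
            · refine ⟨Or.inr (Or.inr ⟨t, ht, rfl⟩), hB1 _ (by simp), ?_⟩
              rintro ⟨u, hu, h⟩
              rw [hinj u (hBC hu) t (Finset.mem_of_mem_erase ht) h] at hu
              exact htB hu

/-- In the alternating sum the empty set contributes `1` and the collapsible part `-1`, so only the
removed bases remain, each with sign `(-1) ^ r`. -/
theorem card_eq_of_collapsible_sdiff (hI : IsIndepFamily I) {r : ℕ} (hr : r ≠ 0)
    {B : Finset (Finset V)} (hBI : B ⊆ I) (hBr : ∀ s ∈ B, s.card = r)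
    (hB : Collapsible (I.erase ∅ \ B)) :
    (B.card : ℤ) = (-1) ^ r * ∑ s ∈ I, (-1 : ℤ) ^ s.card := by
  have hB0 : B ⊆ I.erase ∅ := fun s hs =>
    Finset.mem_erase.2 ⟨fun h => hr (by rw [← hBr s hs, h, Finset.card_empty]), hBI hs⟩
  rw [← Finset.add_sum_erase I _ hI.empty_mem, ← Finset.sum_sdiff hB0, hB.sum_neg_one_pow_card,
    Finset.sum_congr rfl (fun s hs => by rw [hBr s hs]), Finset.sum_const, nsmul_eq_mul]
  have : ((-1 : ℤ) ^ r) * (-1) ^ r = 1 := by rw [← mul_pow]; simp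
  simp only [Finset.card_empty, pow_zero]
  linear_combination (-(B.card : ℤ)) * this

end IsIndepFamily

end Combinatorics

/-! ### Barycentric coordinates; collapsible complexes are contractible. -/

section Realization

variable {V : Type*}

/-- The realization, in barycentric coordinates, of a family of finite sets. -/
def geom (F : Set (Finset V)) : Set (V → ℝ) :=
  {t | (∀ v, 0 ≤ t v) ∧ ∃ s ∈ F, (∀ v, v ∉ s → t v = 0) ∧ ∑ v ∈ s, t v = 1}

theorem realization_eq_geom [Finite V] (K : PreAbstractSimplicialComplex V) :
    realization K = geom K.faces := rfl

/-- The support of a vector of barycentric coordinates. -/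
noncomputable def vsupp [Fintype V] (x : V → ℝ) : Finset V := {v | x v ≠ 0}

@[simp]
theorem mem_vsupp [Fintype V] {x : V → ℝ} {v : V} : v ∈ vsupp x ↔ x v ≠ 0 := by simp [vsupp]

theorem geom_mono {F G : Set (Finset V)} (h : F ⊆ G) : geom F ⊆ geom G :=
  fun _ hx => ⟨hx.1, hx.2.imp fun _ hs => ⟨h hs.1, hs.2⟩⟩

/-- In a complex closed under nonempty subsets the support of a point can always serve as the
witnessing face. -/
theorem mem_geom_iff [Fintype V] {F : Set (Finset V)} (hF : IsRelLowerSet F Finset.Nonempty)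
    {x : V → ℝ} : x ∈ geom F ↔ (∀ v, 0 ≤ x v) ∧ ∑ v, x v = 1 ∧ vsupp x ∈ F := by
  constructor
  · rintro ⟨h0, s, hs, hxs, hsum⟩
    have h1 : ∑ v, x v = 1 := by
      rw [← hsum]
      exact (Finset.sum_subset (Finset.subset_univ s) fun v _ hv => hxs v hv).symm
    refine ⟨h0, h1, (hF hs).2 (fun v hv => ?_) ?_⟩
    · by_contra hvs
      exact mem_vsupp.1 hv (hxs v hvs)
    · by_contra hne
      rw [Finset.not_nonempty_iff_eq_empty, Finset.eq_empty_iff_forall_notMem] at hne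
      have : ∀ v, x v = 0 := fun v => by simpa using hne v
      simp [this] at h1
  · rintro ⟨h0, h1, hs⟩
    refine ⟨h0, _, hs, fun v hv => by simpa using hv, ?_⟩
    rw [← h1]
    exact Finset.sum_subset (Finset.subset_univ _) fun v _ hv => by simpa using hv

theorem vsupp_nonempty [Fintype V] {x : V → ℝ} (hx : ∑ v, x v = 1) : (vsupp x).Nonempty := by
  by_contra hne
  rw [Finset.not_nonempty_iff_eq_empty, Finset.eq_empty_iff_forall_notMem] at hne
  have : ∀ v, x v = 0 := fun v => by simpa using hne v
  simp [this] at hx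

theorem isCompact_geom [Finite V] (F : Set (Finset V)) : IsCompact (geom F) := by
  have := Fintype.ofFinite V
  have h : geom F = ⋃ s ∈ F, {t : V → ℝ | (∀ v, 0 ≤ t v) ∧ (∀ v, v ∉ s → t v = 0) ∧
      ∑ v ∈ s, t v = 1} := by
    ext t
    simp only [geom, Set.mem_ofPred_eq, Set.mem_iUnion, exists_prop]
    exact ⟨fun ⟨h0, s, hs, h⟩ => ⟨s, hs, h0, h⟩, fun ⟨s, hs, h0, h⟩ => ⟨h0, s, hs, h⟩⟩
  rw [h]
  refine (Set.toFinite F).isCompact_biUnion fun s _ => ?_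
  refine (isCompact_Icc (a := (0 : V → ℝ)) (b := 1)).of_isClosed_subset ?_ ?_
  · have h1 : IsClosed {t : V → ℝ | ∀ v, 0 ≤ t v} := by
      simp only [Set.ofPred_forall]
      exact isClosed_iInter fun v => isClosed_le continuous_const (continuous_apply v)
    have h2 : IsClosed {t : V → ℝ | ∀ v, v ∉ s → t v = 0} := by
      simp only [Set.ofPred_forall]
      exact isClosed_iInter fun v => isClosed_iInter fun _ =>
        isClosed_eq (continuous_apply v) continuous_const
    have h3 : IsClosed {t : V → ℝ | ∑ v ∈ s, t v = 1} :=
      isClosed_eq (continuous_finsetSum _ fun v _ => continuous_apply v) continuous_const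
    exact h1.inter (h2.inter h3)
  · rintro t ⟨h0, hs, hsum⟩
    refine ⟨fun v => h0 v, fun v => ?_⟩
    by_cases hv : v ∈ s
    · rw [Pi.one_apply, ← hsum]
      exact Finset.single_le_sum (fun i _ => h0 i) hv
    · rw [hs v hv]
      exact zero_le_one

/-- The smallest value of `x` on `b` (and `0` if `b` is empty). -/
noncomputable def minCoord (b : Finset V) (x : V → ℝ) : ℝ :=
  open Classical in if h : b.Nonempty then b.inf' h x else 0

theorem continuous_minCoord (b : Finset V) : Continuous (minCoord b) := by
  unfold minCoord
  split_ifs with h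
  · exact Continuous.finset_inf'_apply h fun v _ => continuous_apply v
  · exact continuous_const

theorem minCoord_le {b : Finset V} {v : V} (hv : v ∈ b) (x : V → ℝ) : minCoord b x ≤ x v := by
  rw [minCoord, dif_pos ⟨v, hv⟩]
  exact Finset.inf'_le _ hv

theorem exists_eq_minCoord {b : Finset V} (hb : b.Nonempty) (x : V → ℝ) :
    ∃ v ∈ b, x v = minCoord b x := by
  obtain ⟨v, hv, h⟩ := Finset.exists_mem_eq_inf' hb x
  exact ⟨v, hv, by rw [minCoord, dif_pos hb, h]⟩

theorem minCoord_nonneg (b : Finset V) {x : V → ℝ} (hx : ∀ v, 0 ≤ x v) : 0 ≤ minCoord b x := by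
  rcases b.eq_empty_or_nonempty with rfl | hb
  · simp [minCoord]
  · obtain ⟨v, -, h⟩ := exists_eq_minCoord hb x
    exact h ▸ hx v

theorem subset_vsupp_of_minCoord_pos [Fintype V] {b : Finset V} {x : V → ℝ} (h : 0 < minCoord b x) :
    b ⊆ vsupp x :=
  fun _ hv => mem_vsupp.2 (h.trans_le (minCoord_le hv x)).ne'

theorem minCoord_pos_of_subset_vsupp [Fintype V] {b : Finset V} (hb : b.Nonempty) {x : V → ℝ}
    (hx : ∀ v, 0 ≤ x v) (h : b ⊆ vsupp x) : 0 < minCoord b x := by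
  obtain ⟨v, hv, h'⟩ := exists_eq_minCoord hb x
  exact h' ▸ (hx v).lt_of_ne' (mem_vsupp.1 (h hv))

variable [Fintype V] [DecidableEq V]

/-- The old complex is a deformation retract of the new one: the simplex `insert v σ` is pushed away
from its free facet `σ`, towards `v`, until some coordinate in `σ` vanishes. Points of the old
complex do not move, because `σ ∉ F` forces their smallest coordinate on `σ` to be zero. -/
theorem contractibleSpace_expand {F : Finset (Finset V)}
    (hF : IsRelLowerSet (F : Set (Finset V)) Finset.Nonempty) {σ : Finset V} {v : V}
    (hσ : σ.Nonempty) (hv : v ∉ σ) (hσF : σ ∉ F)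
    (hG : IsRelLowerSet ((insert σ (insert (insert v σ) F) : Finset (Finset V)) : Set (Finset V))
      Finset.Nonempty)
    (hc : ContractibleSpace (geom (F : Set (Finset V)))) :
    ContractibleSpace
      (geom ((insert σ (insert (insert v σ) F) : Finset (Finset V)) : Set (Finset V))) := by
  set G := insert σ (insert (insert v σ) F) with hGdef
  -- The entry at `v` makes the coordinates of `w` sum to zero, so moving along `w` keeps the total
  -- equal to one.
  set w : V → ℝ := fun u => if u ∈ σ then 1 else if u = v then -(σ.card : ℝ) else 0 with hw
  have hwsum : ∑ u, w u = 0 := by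
    have h1 : ∀ u, w u = (if u ∈ σ then 1 else 0) + (if u = v then -(σ.card : ℝ) else 0) := by
      intro u
      by_cases hu : u ∈ σ
      · have : u ≠ v := fun h => hv (h ▸ hu)
        simp [hw, hu, this]
      · simp [hw, hu]
    simp [h1, Finset.sum_add_distrib]
  set r : ℝ → (V → ℝ) → V → ℝ := fun s x => x - (s * minCoord σ x) • w with hr
  have hrcont : Continuous fun p : ℝ × (V → ℝ) => r p.1 p.2 := by
    have := continuous_minCoord σ
    fun_prop
  have hFG : (F : Set (Finset V)) ⊆ G := by
    intro s hs
    simp [hGdef, Finset.mem_coe.1 hs]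
  have hrsum : ∀ s x, ∑ u, r s x u = ∑ u, x u := by
    intro s x
    simp [hr, Finset.sum_sub_distrib, ← Finset.mul_sum, hwsum]
  have hτ : insert v σ ∈ (G : Set (Finset V)) := by simp [hGdef]
  have hrG : ∀ s ∈ Set.Icc (0 : ℝ) 1, ∀ x ∈ geom (G : Set (Finset V)),
      r s x ∈ geom (G : Set (Finset V)) := by
    intro s hs x hx
    rw [mem_geom_iff hG] at hx ⊢
    have hm := minCoord_nonneg σ hx.1
    refine ⟨fun u => ?_, (hrsum s x).trans hx.2.1, ?_⟩
    · simp only [hr, hw, Pi.sub_apply, Pi.smul_apply, smul_eq_mul]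
      split_ifs with h1 h2
      · have := minCoord_le h1 x
        nlinarith [hs.1, hs.2]
      · have h3 := hx.1 u
        have h4 : 0 ≤ s * minCoord σ x * (σ.card : ℝ) :=
          mul_nonneg (mul_nonneg hs.1 hm) (Nat.cast_nonneg _)
        linarith
      · simpa using hx.1 u
    · rcases hm.eq_or_lt with h0 | hpos
      · have : r s x = x := by simp [hr, ← h0]
        rw [this]
        exact hx.2.2
      · have hσx := subset_vsupp_of_minCoord_pos hpos
        have hxτ : vsupp x ⊆ insert v σ := by
          have h1 := hx.2.2
          simp only [hGdef, Finset.coe_insert, Set.mem_insert_iff, Finset.mem_coe] at h1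
          rcases h1 with h1 | h1 | h1
          · rw [h1]; exact Finset.subset_insert _ _
          · rw [h1]
          · exact absurd ((hF h1).2 hσx hσ) hσF
        refine (hG hτ).2 (fun u hu => ?_) (vsupp_nonempty ((hrsum s x).trans hx.2.1))
        by_contra hcon
        have h1 : x u = 0 := by
          by_contra h1
          exact hcon (hxτ (mem_vsupp.2 h1))
        rw [Finset.mem_insert, not_or] at hcon
        exact mem_vsupp.1 hu (by simp [hr, hw, h1, hcon.1, hcon.2])
  have hr1 : ∀ x ∈ geom (G : Set (Finset V)), r 1 x ∈ geom (F : Set (Finset V)) := by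
    intro x hx
    have h1 := hrG 1 (by simp) x hx
    rw [mem_geom_iff hG] at h1
    rw [mem_geom_iff hF]
    refine ⟨h1.1, h1.2.1, ?_⟩
    obtain ⟨u, hu, hux⟩ := exists_eq_minCoord hσ x
    have hu0 : u ∉ vsupp (r 1 x) := by simp [hr, hw, hu, hux]
    have h2 := h1.2.2
    simp only [hGdef, Finset.coe_insert, Set.mem_insert_iff, Finset.mem_coe] at h2
    rcases h2 with h2 | h2 | h2
    · exact absurd (h2 ▸ hu) hu0
    · exact absurd (h2 ▸ Finset.mem_insert_of_mem hu) hu0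
    · exact h2
  have hr0 : ∀ x ∈ geom (F : Set (Finset V)), ∀ s, r s x = x := by
    intro x hx s
    rw [mem_geom_iff hF] at hx
    have : minCoord σ x = 0 := by
      refine le_antisymm (not_lt.1 fun hpos => ?_) (minCoord_nonneg σ hx.1)
      exact hσF ((hF hx.2.2).2 (subset_vsupp_of_minCoord_pos hpos) hσ)
    simp [hr, this]
  let i : C(geom (F : Set (Finset V)), geom (G : Set (Finset V))) :=
    ⟨fun x => ⟨x.1, geom_mono hFG x.2⟩, by fun_prop⟩
  let ρ : C(geom (G : Set (Finset V)), geom (F : Set (Finset V))) :=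
    ⟨fun x => ⟨r 1 x.1, hr1 x.1 x.2⟩,
      (hrcont.comp (continuous_const.prodMk continuous_subtype_val)).subtype_mk _⟩
  let H : ContinuousMap.Homotopy (ContinuousMap.id (geom (G : Set (Finset V)))) (i.comp ρ) :=
    { toFun := fun p => ⟨r p.1 p.2.1, hrG _ p.1.2 _ p.2.2⟩
      continuous_toFun := (hrcont.comp ((continuous_subtype_val.comp continuous_fst).prodMk
        (continuous_subtype_val.comp continuous_snd))).subtype_mk _
      map_zero_left := fun x => Subtype.ext (by simp [hr])
      map_one_left := fun x => rfl }
  have e : ContinuousMap.HomotopyEquiv (geom (G : Set (Finset V))) (geom (F : Set (Finset V))) :=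
    { toFun := ρ
      invFun := i
      left_inv := ⟨H.symm⟩
      right_inv := by
        have : ρ.comp i = ContinuousMap.id _ := by
          ext x : 1
          exact Subtype.ext (hr0 x.1 x.2 1)
        rw [this] }
  exact e.contractibleSpace

theorem Collapsible.contractibleSpace {F : Finset (Finset V)} (hF : Collapsible F) :
    ContractibleSpace (geom (F : Set (Finset V))) := by
  induction hF with
  | vertex v =>
    have hlow := (Collapsible.vertex v).isRelLowerSet
    have h : ∀ x ∈ geom ((({{v}} : Finset (Finset V))) : Set (Finset V)), x = Pi.single v 1 := by
      rintro x ⟨-, s, hs, hx, hsum⟩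
      obtain rfl : s = {v} := by simpa using hs
      ext u
      by_cases hu : u = v
      · subst hu
        simpa using hsum
      · rw [hx u (by simpa using hu), Pi.single_eq_of_ne hu]
    have : Subsingleton (geom ((({{v}} : Finset (Finset V))) : Set (Finset V))) :=
      ⟨fun x y => Subtype.ext ((h x x.2).trans (h y y.2).symm)⟩
    have : Nonempty (geom ((({{v}} : Finset (Finset V))) : Set (Finset V))) := by
      refine ⟨⟨Pi.single v 1, fun u => ?_, {v}, by simp, fun u hu => ?_, by simp⟩⟩
      · by_cases hu : u = v
        · subst hu; simp
        · simp [hu]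
      · exact Pi.single_eq_of_ne (by simpa using hu) _
    infer_instance
  | @expand F σ v hF hσ hv hσF h ih =>
    exact contractibleSpace_expand hF.isRelLowerSet hσ hv hσF
      (hF.expand hσ hv hσF h).isRelLowerSet ih

end Realization

/-! ### Collapsing subspaces and one-point compactifications. -/

section Collapse

/-- Collapsing a subspace `A` which contracts inside `A` along a homotopy of the whole space is a
homotopy equivalence. -/
theorem nonempty_homotopyEquiv_of_collapse {X Z : Type*} [TopologicalSpace X] [CompactSpace X]
    [TopologicalSpace Z] [T2Space Z] (f : C(X, Z)) (hf : Function.Surjective f) (A : Set X)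
    (hfib : ∀ x y, f x = f y → x = y ∨ (x ∈ A ∧ y ∈ A)) (z₀ : Z) (hA : ∀ x ∈ A, f x = z₀)
    (H : C(unitInterval × X, X)) (h0 : ∀ x, H (0, x) = x) (hHA : ∀ t, ∀ x ∈ A, H (t, x) ∈ A)
    (x₀ : X) (h1 : ∀ x ∈ A, H (1, x) = x₀) : Nonempty (ContinuousMap.HomotopyEquiv X Z) := by
  have hq : Topology.IsQuotientMap f := f.continuous.isClosedMap.isQuotientMap f.continuous hf
  let H₁ : C(X, X) := H.comp ⟨fun x => (1, x), by fun_prop⟩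
  -- The end map of `H` is constant on `A`, so it factors through `f`; this factor is the homotopy
  -- inverse.
  let g : C(Z, X) := hq.lift H₁ (by
    intro x y hxy
    rcases hfib x y hxy with rfl | ⟨hx, hy⟩
    · rfl
    · exact (h1 x hx).trans (h1 y hy).symm)
  have hgf : g.comp f = H₁ := hq.lift_comp _ _
  -- By compactness the product with the interval is again a quotient map, so `H` descends to a
  -- homotopy `K` on `Z`.
  let q : C(unitInterval × X, unitInterval × Z) := ⟨Prod.map id f, by fun_prop⟩
  have hqq : Topology.IsQuotientMap q :=
    q.continuous.isClosedMap.isQuotientMap q.continuous (Function.surjective_id.prodMap hf)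
  have hfH : ∀ a b, q a = q b → f.comp H a = f.comp H b := by
    rintro ⟨s, x⟩ ⟨t, y⟩ hxy
    obtain ⟨hst, hxy'⟩ := Prod.mk.inj (show (s, f x) = (t, f y) from hxy)
    subst hst
    rcases hfib x y hxy' with rfl | ⟨hx, hy⟩
    · rfl
    · exact (hA _ (hHA _ x hx)).trans (hA _ (hHA _ y hy)).symm
  let K : C(unitInterval × Z, Z) := hqq.lift (f.comp H) hfH
  have hK : ∀ t x, K (t, f x) = f (H (t, x)) := fun t x =>
    congrArg (fun k : C(unitInterval × X, Z) => k (t, x)) (hqq.lift_comp (f.comp H) hfH)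
  have hgf' : ∀ x, g (f x) = H (1, x) := fun x => congrArg (fun k : C(X, X) => k x) hgf
  refine ⟨⟨f, g, ?_, ?_⟩⟩
  · refine ContinuousMap.Homotopic.symm ⟨⟨H, h0, fun x => ?_⟩⟩
    exact (hgf' x).symm
  · refine ContinuousMap.Homotopic.symm ⟨⟨K, fun z => ?_, fun z => ?_⟩⟩
    · obtain ⟨x, rfl⟩ := hf z
      exact (hK 0 x).trans (by rw [h0]; rfl)
    · obtain ⟨x, rfl⟩ := hf z
      exact (hK 1 x).trans (by rw [← hgf']; rfl)

/-- The map that collapses the complement of an open subset to the point at infinity. -/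
theorem continuous_collapse_compl {X Z : Type*} [TopologicalSpace X] [T2Space X]
    [TopologicalSpace Z] {U : Set X} [∀ x, Decidable (x ∈ U)] (hU : IsOpen U) {ψ : X → Z}
    (hψ : ContinuousOn ψ U) {g : Z → X} (hg : Continuous g) (hgU : ∀ z, g z ∈ U)
    (hψg : ∀ z, ψ (g z) = z) (hgψ : ∀ x ∈ U, g (ψ x) = x) :
    Continuous fun x => if x ∈ U then ((ψ x : Z) : OnePoint Z) else OnePoint.infty := by
  rw [continuous_def]
  intro s hs
  rw [OnePoint.isOpen_def] at hs
  by_cases hinf : OnePoint.infty ∈ s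
  -- The complement of the preimage is the image under `g` of the compact complement of `s`.
  · have h2 := ((hs.1 hinf).image hg).isClosed
    rw [← isClosed_compl_iff]
    convert h2 using 1
    ext x
    simp only [Set.mem_compl_iff, Set.mem_preimage, Set.mem_image]
    constructor
    · intro hx
      by_cases hxU : x ∈ U
      · rw [if_pos hxU] at hx
        exact ⟨ψ x, hx, hgψ x hxU⟩
      · rw [if_neg hxU] at hx
        exact absurd hinf hx
    · rintro ⟨z, hz, rfl⟩
      rw [if_pos (hgU z), hψg]
      exact hz
  · have h2 := hψ.isOpen_inter_preimage hU hs.2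
    convert h2 using 1
    ext x
    simp only [Set.mem_preimage, Set.mem_inter_iff]
    by_cases hxU : x ∈ U
    · simp [hxU]
    · simp [hxU, hinf]

/-- The sphere as the one-point compactification of Euclidean space, with a prescribed point at
infinity. -/
theorem exists_onePoint_homeomorph_sphere {d : ℕ} (v : UnitSphere d) :
    ∃ o : OnePoint (EuclideanSpace ℝ (Fin d)) ≃ₜ UnitSphere d, o OnePoint.infty = v := by
  have : Fact (Module.finrank ℝ (EuclideanSpace ℝ (Fin (d + 1))) = d + 1) := ⟨by simp⟩
  let e := stereographic' d v
  have ht : e.target = Set.univ := stereographic'_target v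
  have hcont : Continuous e.symm := by
    rw [← continuousOn_univ, ← ht]
    exact e.continuousOn_symm
  have hemb : Topology.IsEmbedding e.symm :=
    (e.symm.isOpenEmbedding (by simpa using ht)).isEmbedding
  have hrange : Set.range e.symm = {v}ᶜ := by
    rw [← stereographic'_source (n := d) v, ← Set.image_univ, ← ht]
    exact e.symm_image_target_eq_source
  exact ⟨OnePoint.equivOfIsEmbeddingOfRangeEq v e.symm hemb hrange, rfl⟩

end Collapse

/-! ### A wedge as a subspace of the product. -/

section WedgeEmbedding

variable {ι : Type*} {X : ι → Type*} (x₀ : ∀ i, X i)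

theorem compactSpace_wedge [Finite ι] [∀ i, TopologicalSpace (X i)] [∀ i, CompactSpace (X i)] :
    CompactSpace (Wedge X x₀) :=
  inferInstanceAs (CompactSpace (Quot (WedgeRel X x₀)))

variable [DecidableEq ι]

/-- The map from a wedge to the product. -/
def wedgeToPi : Wedge X x₀ → ∀ i, X i :=
  Quot.lift (Sum.elim (fun _ => x₀) fun p => Function.update x₀ p.1 p.2) (by
    rintro _ _ ⟨i⟩
    simp)

/-- A point away from the base point is recovered from the only coordinate in which its image
differs from `x₀`. Injectivity makes the wedge Hausdorff, and for finitely many compact Hausdorff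
factors it makes the map to the product a closed embedding. -/
theorem wedgeToPi_injective : Function.Injective (wedgeToPi x₀) := by
  have hbase : ∀ i, (Quot.mk _ (Sum.inr ⟨i, x₀ i⟩) : Wedge X x₀) = Quot.mk _ (Sum.inl ()) :=
    fun i => (Quot.sound (WedgeRel.glue i)).symm
  have key : ∀ i (x : X i) (j) (y : X j),
      Function.update x₀ i x = Function.update x₀ j y →
      (Quot.mk _ (Sum.inr ⟨i, x⟩) : Wedge X x₀) = Quot.mk _ (Sum.inr ⟨j, y⟩) := by
    intro i x j y h
    by_cases hij : i = j
    · subst hij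
      have := congrFun h i
      simp only [Function.update_self] at this
      rw [this]
    · have hi := congrFun h i
      have hj := congrFun h j
      rw [Function.update_self, Function.update_of_ne hij] at hi
      rw [Function.update_self, Function.update_of_ne (Ne.symm hij)] at hj
      rw [hi, ← hj, hbase, hbase]
  rintro ⟨⟨⟩ | ⟨i, x⟩⟩ ⟨⟨⟩ | ⟨j, y⟩⟩ h
  · rfl
  · rw [← hbase j]
    exact key j (x₀ j) j y (by simpa [wedgeToPi] using h)
  · rw [← hbase i]
    exact key i x i (x₀ i) (by simpa [wedgeToPi] using h)
  · exact key i x j y h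

theorem continuous_wedgeToPi [∀ i, TopologicalSpace (X i)] : Continuous (wedgeToPi x₀) := by
  refine continuous_quot_lift _ (Continuous.sumElim continuous_const ?_)
  refine continuous_sigma fun i => continuous_const.update i continuous_id

/-- The first alternative is needed for an empty index set, where no `i` exists but the wedge is
still a point. -/
theorem mem_range_wedgeToPi (y : ∀ i, X i)
    (h : (∀ i, y i = x₀ i) ∨ ∃ i, ∀ j, j ≠ i → y j = x₀ j) : y ∈ Set.range (wedgeToPi x₀) := by
  rcases h with h | ⟨i, h⟩
  · exact ⟨Quot.mk _ (Sum.inl ()), (funext h).symm⟩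
  · refine ⟨Quot.mk _ (Sum.inr ⟨i, y i⟩), funext fun j => ?_⟩
    by_cases hj : j = i
    · subst hj
      simp [wedgeToPi]
    · simp [wedgeToPi, hj, h j hj]

theorem wedgeToPi_cases (w : Wedge X x₀) :
    wedgeToPi x₀ w = x₀ ∨ ∃ i x, x ≠ x₀ i ∧ wedgeToPi x₀ w = Function.update x₀ i x := by
  rcases w with ⟨⟨⟩ | ⟨i, x⟩⟩
  · exact Or.inl rfl
  · by_cases hx : x = x₀ i
    · subst hx
      exact Or.inl (by simp [wedgeToPi])
    · exact Or.inr ⟨i, x, hx, rfl⟩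

instance [∀ i, TopologicalSpace (X i)] [∀ i, T2Space (X i)] : T2Space (Wedge X x₀) :=
  T2Space.of_injective_continuous (wedgeToPi_injective x₀) (continuous_wedgeToPi x₀)

end WedgeEmbedding

/-! ### Collapsing all but one open top simplex to a sphere. -/

section OpenSimplex

variable {V : Type*} [Fintype V] [DecidableEq V]

/-- The open simplex `b` is open in the complex because `b` has the largest possible cardinality,
and it is homeomorphic to `ℝ^d`. Sending everything else to infinity gives a map to the one-point
compactification, which is the sphere. -/
theorem exists_collapse_to_sphere {F : Finset (Finset V)}
    (hF : IsRelLowerSet (F : Set (Finset V)) Finset.Nonempty) {d : ℕ}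
    (hmax : ∀ s ∈ F, s.card ≤ d + 1) {b : Finset V} (hb : b ∈ F) (hbd : b.card = d + 1) :
    ∃ φ : C(geom (F : Set (Finset V)), UnitSphere d),
      (∀ x, φ x = sphereBase d ↔ minCoord b x.1 = 0) ∧
      (∀ x y, φ x = φ y → φ x ≠ sphereBase d → x = y) ∧
      (∀ z, z ≠ sphereBase d → ∃ x, φ x = z) := by
  classical
  obtain ⟨o, ho⟩ := exists_onePoint_homeomorph_sphere (sphereBase d)
  let e : Fin (d + 1) ≃ b := (finCongr hbd.symm).trans b.equivFin.symm
  have hbne : b.Nonempty := Finset.card_pos.1 (by omega)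
  let U : Set (geom (F : Set (Finset V))) := {x | 0 < minCoord b x.1}
  have hU : IsOpen U :=
    isOpen_lt continuous_const ((continuous_minCoord b).comp continuous_subtype_val)
  -- Logarithms of the ratios to the zeroth coordinate; the inverse is the normalized exponential
  -- `g'`, with zeroth exponent `0`.
  let ψ : geom (F : Set (Finset V)) → EuclideanSpace ℝ (Fin d) := fun x =>
    WithLp.toLp 2 fun j => Real.log (x.1 (e j.succ)) - Real.log (x.1 (e 0))
  have hne : ∀ x ∈ U, ∀ j, x.1 (e j) ≠ 0 := fun x hx j =>
    (lt_of_lt_of_le hx (minCoord_le (e j).2 x.1)).ne'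
  have hψ : ContinuousOn ψ U := by
    refine (PiLp.continuous_toLp 2 _).comp_continuousOn (continuousOn_pi.2 fun j => ?_)
    have hc : ∀ j, ContinuousOn (fun x : geom (F : Set (Finset V)) => x.1 (e j)) U := fun j =>
      ((continuous_apply _).comp continuous_subtype_val).continuousOn
    exact ((hc j.succ).log fun x hx => hne x hx _).sub ((hc 0).log fun x hx => hne x hx _)
  let zz : EuclideanSpace ℝ (Fin d) → Fin (d + 1) → ℝ := fun z => Fin.cons 0 fun j => z j
  have hS : ∀ z, 0 < ∑ j, Real.exp (zz z j) := fun z =>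
    Finset.sum_pos (fun j _ => Real.exp_pos _) Finset.univ_nonempty
  let g' : EuclideanSpace ℝ (Fin d) → V → ℝ := fun z v =>
    if h : v ∈ b then Real.exp (zz z (e.symm ⟨v, h⟩)) / ∑ j, Real.exp (zz z j) else 0
  have hg'e : ∀ z j, g' z (e j) = Real.exp (zz z j) / ∑ j, Real.exp (zz z j) := by
    intro z j
    simp only [g', dif_pos (e j).2, Subtype.coe_eta, Equiv.symm_apply_apply]
  have hsum : ∀ x : V → ℝ, ∑ v ∈ b, x v = ∑ j, x (e j) := fun x => by
    rw [← Finset.sum_coe_sort b, ← Equiv.sum_comp e]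
  have hg'mem : ∀ z, g' z ∈ geom (F : Set (Finset V)) := by
    refine fun z => ⟨fun v => ?_, b, hb, fun v hv => dif_neg hv, ?_⟩
    · simp only [g']
      split_ifs
      · exact div_nonneg (Real.exp_pos _).le (hS z).le
      · exact le_rfl
    · rw [hsum]
      simp only [hg'e]
      rw [← Finset.sum_div, div_self (hS z).ne']
  let g : EuclideanSpace ℝ (Fin d) → geom (F : Set (Finset V)) := fun z => ⟨g' z, hg'mem z⟩
  have hzz : ∀ j, Continuous fun z => zz z j := by
    intro j
    refine Fin.cases ?_ (fun j => ?_) j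
    · exact continuous_const
    · simp only [zz, Fin.cons_succ]
      fun_prop
  have hg : Continuous g := by
    refine Continuous.subtype_mk (continuous_pi fun v => ?_) _
    simp only [g']
    split_ifs
    · exact (Real.continuous_exp.comp (hzz _)).div
        (continuous_finsetSum _ fun j _ => Real.continuous_exp.comp (hzz j)) fun z => (hS z).ne'
    · exact continuous_const
  have hgU : ∀ z, g z ∈ U := by
    intro z
    obtain ⟨v, hv, h⟩ := exists_eq_minCoord hbne (g' z)
    change 0 < minCoord b (g' z)
    rw [← h]
    simp only [g', dif_pos hv]
    exact div_pos (Real.exp_pos _) (hS z)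
  have hψg : ∀ z, ψ (g z) = z := by
    intro z
    ext j
    change Real.log (g' z (e j.succ)) - Real.log (g' z (e 0)) = z j
    rw [hg'e, hg'e, Real.log_div (Real.exp_pos _).ne' (hS z).ne',
      Real.log_div (Real.exp_pos _).ne' (hS z).ne', Real.log_exp, Real.log_exp]
    simp [zz]
  have hgψ : ∀ x ∈ U, g (ψ x) = x := by
    intro x hx
    have hxF := (mem_geom_iff hF).1 x.2
    have hsupp : vsupp x.1 = b :=
      (Finset.eq_of_subset_of_card_le (subset_vsupp_of_minCoord_pos hx)
        (by rw [hbd]; exact hmax _ hxF.2.2)).symm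
    have hpos : ∀ j, 0 < x.1 (e j) := fun j => (hxF.1 _).lt_of_ne' (hne x hx j)
    have hexp : ∀ j, Real.exp (zz (ψ x) j) = x.1 (e j) / x.1 (e 0) := by
      intro j
      refine Fin.cases ?_ (fun j => ?_) j
      · simp [zz, div_self (hne x hx 0)]
      · change Real.exp (Real.log (x.1 (e j.succ)) - Real.log (x.1 (e 0))) = _
        rw [Real.exp_sub, Real.exp_log (hpos _), Real.exp_log (hpos _)]
    have hx1 : ∑ j, x.1 (e j) = 1 := by
      rw [← hsum, ← hxF.2.1]
      refine Finset.sum_subset (Finset.subset_univ _) fun v _ hv => ?_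
      by_contra h
      exact hv (hsupp ▸ mem_vsupp.2 h)
    apply Subtype.ext
    funext v
    change g' (ψ x) v = x.1 v
    by_cases hv : v ∈ b
    · obtain ⟨j, hj⟩ := e.surjective ⟨v, hv⟩
      have hj' : v = e j := by rw [hj]
      rw [hj', hg'e]
      simp only [hexp]
      rw [← Finset.sum_div, hx1]
      field_simp [hne x hx 0]
    · simp only [g', dif_neg hv]
      by_contra h
      exact hv (hsupp ▸ mem_vsupp.2 (Ne.symm h))
  have hφ := continuous_collapse_compl hU hψ hg hgU hψg hgψ
  have hbase : ∀ p, o p = sphereBase d ↔ p = OnePoint.infty := fun p => by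
    rw [← ho, o.injective.eq_iff]
  refine ⟨⟨fun x => o (if x ∈ U then ((ψ x : EuclideanSpace ℝ (Fin d)) : OnePoint _)
    else OnePoint.infty), o.continuous.comp hφ⟩, fun x => ?_, fun x y hxy hx => ?_, fun z hz => ?_⟩
  · have hnn := minCoord_nonneg b ((mem_geom_iff hF).1 x.2).1
    rw [ContinuousMap.coe_mk, hbase]
    by_cases hx : x ∈ U
    · simp only [hx, if_true, OnePoint.coe_ne_infty, false_iff]
      exact (show 0 < minCoord b x.1 from hx).ne'
    · simp only [hx, if_false, true_iff]
      exact le_antisymm (not_lt.1 hx) hnn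
  · simp only [ContinuousMap.coe_mk] at hxy hx
    rw [ne_eq, hbase] at hx
    have hxU : x ∈ U := by
      by_contra h
      simp [h] at hx
    have hxy := o.injective hxy
    have hyU : y ∈ U := by
      by_contra h
      simp [h, hxU] at hxy
    rw [if_pos hxU, if_pos hyU, OnePoint.coe_eq_coe] at hxy
    rw [← hgψ x hxU, hxy, hgψ y hyU]
  · obtain ⟨p, rfl⟩ := o.surjective z
    rw [ne_eq, hbase] at hz
    obtain ⟨u, rfl⟩ := OnePoint.ne_infty_iff_exists.1 hz
    refine ⟨g u, ?_⟩
    simp only [ContinuousMap.coe_mk]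
    rw [if_pos (hgU u), hψg]

end OpenSimplex

/-! ### Extending the contraction and passing to a wedge of spheres. -/

section HomotopyExtension

variable {V : Type*} [Fintype V] [DecidableEq V]

theorem mem_geom_sdiff_iff {F B : Finset (Finset V)}
    (hF : IsRelLowerSet (F : Set (Finset V)) Finset.Nonempty)
    (hFB : IsRelLowerSet ((F \ B : Finset _) : Set (Finset V)) Finset.Nonempty)
    (hB : B ⊆ F) (hmax : ∀ b ∈ B, ∀ s ∈ F, b ⊆ s → s = b) {x : V → ℝ}
    (hx : x ∈ geom (F : Set (Finset V))) :
    x ∈ geom ((F \ B : Finset _) : Set (Finset V)) ↔ ∀ b ∈ B, minCoord b x = 0 := by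
  rw [mem_geom_iff hF] at hx
  rw [mem_geom_iff hFB]
  simp only [Finset.coe_sdiff, Set.mem_sdiff, Finset.mem_coe]
  constructor
  · rintro ⟨-, -, -, h⟩ b hb
    refine le_antisymm (not_lt.1 fun hpos => h ?_) (minCoord_nonneg b hx.1)
    rw [hmax b hb _ hx.2.2 (subset_vsupp_of_minCoord_pos hpos)]
    exact hb
  · intro h
    refine ⟨hx.1, hx.2.1, hx.2.2, fun hb => ?_⟩
    exact (minCoord_pos_of_subset_vsupp (hF (hB hb)).1 hx.1 subset_rfl).ne' (h _ hb)

/-- A contraction of a subcomplex whose complement consists of top-dimensional simplices extends to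
a homotopy of the whole complex. -/
theorem exists_extend_contraction {F B : Finset (Finset V)}
    (hF : IsRelLowerSet (F : Set (Finset V)) Finset.Nonempty)
    (hFB : IsRelLowerSet ((F \ B : Finset _) : Set (Finset V)) Finset.Nonempty)
    (hB : B ⊆ F) {d : ℕ} (hmax : ∀ s ∈ F, s.card ≤ d + 1) (hBd : ∀ b ∈ B, b.card = d + 1)
    (hc : ContractibleSpace (geom ((F \ B : Finset _) : Set (Finset V)))) :
    ∃ (H : C(unitInterval × geom (F : Set (Finset V)), geom (F : Set (Finset V))))
      (x₀ : geom (F : Set (Finset V))),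
      (∀ x, H (0, x) = x) ∧
      (∀ t, ∀ x : geom (F : Set (Finset V)), x.1 ∈ geom ((F \ B : Finset _) : Set (Finset V)) →
        (H (t, x)).1 ∈ geom ((F \ B : Finset _) : Set (Finset V))) ∧
      ∀ x : geom (F : Set (Finset V)), x.1 ∈ geom ((F \ B : Finset _) : Set (Finset V)) →
        H (1, x) = x₀ := by
  classical
  obtain ⟨y₀, ⟨h⟩⟩ := id_nullhomotopic (geom ((F \ B : Finset _) : Set (Finset V)))
  have hmax' : ∀ b ∈ B, ∀ s ∈ F, b ⊆ s → s = b := fun b hb s hs hbs =>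
    (Finset.eq_of_subset_of_card_le hbs (by rw [hBd b hb]; exact hmax s hs)).symm
  have hmem := fun {x : V → ℝ} => mem_geom_sdiff_iff hF hFB hB hmax' (x := x)
  have hsub : geom ((F \ B : Finset _) : Set (Finset V)) ⊆ geom (F : Set (Finset V)) :=
    geom_mono (by rw [Finset.coe_sdiff]; exact Set.sdiff_subset)
  have hcases : ∀ x ∈ geom (F : Set (Finset V)), (∀ b ∈ B, minCoord b x = 0) ∨
      ∃ b ∈ B, 0 < minCoord b x ∧ vsupp x = b ∧ ∀ c ∈ B, c ≠ b → minCoord c x = 0 := by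
    intro x hx
    rw [mem_geom_iff hF] at hx
    by_cases h0 : ∀ b ∈ B, minCoord b x = 0
    · exact Or.inl h0
    push Not at h0
    obtain ⟨b, hb, hbx⟩ := h0
    have hpos := (minCoord_nonneg b hx.1).lt_of_ne' hbx
    have hsupp := hmax' b hb _ hx.2.2 (subset_vsupp_of_minCoord_pos hpos)
    refine Or.inr ⟨b, hb, hpos, hsupp, fun c hc hcb => ?_⟩
    refine le_antisymm (not_lt.1 fun hcpos => hcb ?_) (minCoord_nonneg c hx.1)
    rw [← hsupp, hmax' c hc _ hx.2.2 (subset_vsupp_of_minCoord_pos hcpos)]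
  -- Half of the coordinate `1 / (d + 1)` of the barycentre of a top simplex: subtracting at most
  -- `ε` from each of the `d + 1` coordinates leaves at least half of the total mass, so `P` can
  -- rescale.
  set ε : ℝ := 1 / (2 * (d + 1)) with hε
  have hd : (0 : ℝ) < d + 1 := by positivity
  have hε0 : 0 < ε := by positivity
  have hεd : (d + 1) * ε = 1 / 2 := by rw [hε]; field_simp
  let a : ℝ → (V → ℝ) → Finset V → ℝ := fun t x b => min (minCoord b x) (t * ε)
  -- `P` pushes each open simplex of `B` radially away from its barycentre. At time `t` the points
  -- with `M x ≤ t * ε` have reached the boundary. Open simplices are disjoint, so at most one term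
  -- of each sum is nonzero.
  let P : ℝ → (V → ℝ) → V → ℝ := fun t x v =>
    (x v - ∑ b ∈ B, if v ∈ b then a t x b else 0) / (1 - (d + 1) * ∑ b ∈ B, a t x b)
  let M : (V → ℝ) → ℝ := fun x => ∑ b ∈ B, minCoord b x
  have hMcont : Continuous M := continuous_finsetSum _ fun b _ => continuous_minCoord b
  have hone : ∀ (x : V → ℝ) (b), b ∈ B → (∀ c ∈ B, c ≠ b → minCoord c x = 0) →
      ∀ t, 0 ≤ t → M x = minCoord b x ∧ (∑ c ∈ B, a t x c = a t x b) ∧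
      ∀ v, (∑ c ∈ B, if v ∈ c then a t x c else 0) = if v ∈ b then a t x b else 0 := by
    intro x b hb hbx t ht
    have ha : ∀ c ∈ B, c ≠ b → a t x c = 0 := fun c hc hcb => by
      simp only [a, hbx c hc hcb]
      exact min_eq_left (by positivity)
    refine ⟨Finset.sum_eq_single_of_mem b hb hbx, Finset.sum_eq_single_of_mem b hb ha,
      fun v => Finset.sum_eq_single_of_mem b hb fun c hc hcb => ?_⟩
    rw [ha c hc hcb, ite_self]
  have hM0 : ∀ x ∈ geom (F : Set (Finset V)), 0 ≤ M x := fun x hx =>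
    Finset.sum_nonneg fun b _ => minCoord_nonneg b hx.1
  have hPid : ∀ t x, (∀ b ∈ B, a t x b = 0) → P t x = x := by
    intro t x h0
    funext v
    have h1 : (∑ b ∈ B, if v ∈ b then a t x b else 0) = 0 :=
      Finset.sum_eq_zero fun b hb => by rw [h0 b hb, ite_self]
    simp only [P]
    rw [Finset.sum_eq_zero h0, h1]
    simp
  have hPzero : ∀ t x, 0 ≤ t → (∀ b ∈ B, minCoord b x = 0) → P t x = x := by
    intro t x ht h0
    refine hPid t x fun b hb => ?_
    simp only [a, h0 b hb]
    exact min_eq_left (by positivity)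
  have hP0 : ∀ x ∈ geom (F : Set (Finset V)), P 0 x = x := by
    intro x hx
    refine hPid 0 x fun b _ => ?_
    simp only [a, zero_mul]
    exact min_eq_right (minCoord_nonneg b hx.1)
  have hden : ∀ t ∈ Set.Icc (0 : ℝ) 1, ∀ x ∈ geom (F : Set (Finset V)),
      1 / 2 ≤ 1 - (d + 1) * ∑ b ∈ B, a t x b := by
    intro t ht x hx
    rcases hcases x hx with h0 | ⟨b, hb, -, -, hbx⟩
    · have : ∑ b ∈ B, a t x b = 0 := Finset.sum_eq_zero fun b hb => by
        simp only [a, h0 b hb]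
        exact min_eq_left (mul_nonneg ht.1 hε0.le)
      rw [this]
      norm_num
    · rw [(hone x b hb hbx t ht.1).2.1]
      have h1 : a t x b ≤ ε := (min_le_right _ _).trans (mul_le_of_le_one_left hε0.le ht.2)
      nlinarith
  have hPmem : ∀ t ∈ Set.Icc (0 : ℝ) 1, ∀ x ∈ geom (F : Set (Finset V)),
      P t x ∈ geom (F : Set (Finset V)) ∧
      (M x ≤ t * ε → P t x ∈ geom ((F \ B : Finset _) : Set (Finset V))) := by
    intro t ht x hx
    rcases hcases x hx with h0 | ⟨b, hb, hpos, hsupp, hbx⟩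
    · rw [hPzero t x ht.1 h0]
      exact ⟨hx, fun _ => (hmem hx).2 h0⟩
    · obtain ⟨h1, h2, h3⟩ := hone x b hb hbx t ht.1
      have hD := hden t ht x hx
      have hPv : ∀ v, P t x v = (x v - if v ∈ b then a t x b else 0) / (1 - (d + 1) * a t x b) := by
        intro v
        simp only [P]
        rw [h2, h3]
      rw [h2] at hD
      have hDpos : 0 < 1 - (d + 1) * a t x b := by linarith
      have hxF := (mem_geom_iff hF).1 hx
      have hsum : ∑ v, P t x v = 1 := by
        simp only [hPv]
        rw [← Finset.sum_div, Finset.sum_sub_distrib, hxF.2.1, Finset.sum_ite_mem,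
          Finset.univ_inter, Finset.sum_const, hBd b hb, nsmul_eq_mul]
        push_cast
        exact div_self hDpos.ne'
      have hPsupp : vsupp (P t x) ⊆ b := by
        intro v hv
        by_contra hvb
        have hxv : x v = 0 := by
          by_contra h
          exact hvb (hsupp ▸ mem_vsupp.2 h)
        exact mem_vsupp.1 hv (by simp [hPv, hvb, hxv])
      have hPF : P t x ∈ geom (F : Set (Finset V)) := by
        rw [mem_geom_iff hF]
        refine ⟨fun v => ?_, hsum, (hF (hB hb)).2 hPsupp (vsupp_nonempty hsum)⟩
        rw [hPv]
        refine div_nonneg ?_ hDpos.le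
        split_ifs with hvb
        · have := minCoord_le hvb x
          have := min_le_left (minCoord b x) (t * ε)
          simp only [a]
          linarith
        · simpa using hxF.1 v
      refine ⟨hPF, fun hM => (hmem hPF).2 ?_⟩
      rw [h1] at hM
      have ha : a t x b = minCoord b x := min_eq_left hM
      obtain ⟨v, hv, hvx⟩ := exists_eq_minCoord (hF (hB hb)).1 x
      have hPv0 : P t x v = 0 := by
        rw [hPv, if_pos hv, ha, hvx, sub_self, zero_div]
      intro c hc
      refine le_antisymm (not_lt.1 fun hcpos => ?_) (minCoord_nonneg c hPF.1)
      have hcb := (subset_vsupp_of_minCoord_pos hcpos).trans hPsupp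
      have := hmax' c hc b (hB hb) hcb
      subst this
      exact absurd (minCoord_le hv (P t x)) (by rw [hPv0]; exact not_le.2 hcpos)
  have hPcont : Continuous fun p : unitInterval × geom (F : Set (Finset V)) => P p.1 p.2.1 := by
    have hacont : ∀ b, Continuous fun p : unitInterval × geom (F : Set (Finset V)) =>
        a p.1 p.2.1 b := fun b =>
      ((continuous_minCoord b).comp (continuous_subtype_val.comp continuous_snd)).min
        ((continuous_subtype_val.comp continuous_fst).mul continuous_const)
    refine continuous_pi fun v => Continuous.div ?_ ?_ fun p => ?_
    · refine ((continuous_apply v).comp (continuous_subtype_val.comp continuous_snd)).sub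
        (continuous_finsetSum _ fun b _ => ?_)
      split_ifs
      · exact hacont b
      · exact continuous_const
    · exact continuous_const.sub (continuous_const.mul (continuous_finsetSum _ fun b _ => hacont b))
    · have := hden p.1 p.1.2 p.2.1 p.2.2
      exact (by linarith : (0 : ℝ) < 1 - (d + 1) * ∑ b ∈ B, a p.1 p.2.1 b).ne'
  let S : Set (ℝ × (V → ℝ)) := {p | p.1 ∈ Set.Icc (0 : ℝ) 1 ∧
    p.2 ∈ geom ((F \ B : Finset _) : Set (Finset V))}
  -- The contraction `h` as a total function; the value `0` off `S` is never used.
  let k : ℝ × (V → ℝ) → V → ℝ := fun p =>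
    if hp : p ∈ S then (h (⟨p.1, hp.1⟩, ⟨p.2, hp.2⟩)).1 else 0
  have hk : ContinuousOn k S := by
    rw [continuousOn_iff_continuous_domRestrict]
    have : S.domRestrict k = fun p => (h (⟨p.1.1, p.2.1⟩, ⟨p.1.2, p.2.2⟩)).1 := by
      funext p
      exact dif_pos p.2
    rw [this]
    fun_prop
  have hkmem : ∀ p ∈ S, k p ∈ geom ((F \ B : Finset _) : Set (Finset V)) := by
    intro p hp
    simp only [k, dif_pos hp]
    exact Subtype.coe_prop _
  have hk0 : ∀ x ∈ geom ((F \ B : Finset _) : Set (Finset V)), k (0, x) = x := by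
    intro x hx
    have hp : ((0 : ℝ), x) ∈ S := ⟨by simp, hx⟩
    simp only [k, dif_pos hp]
    exact congrArg Subtype.val (h.apply_zero ⟨x, hx⟩)
  have hk1 : ∀ x ∈ geom ((F \ B : Finset _) : Set (Finset V)), k (1, x) = y₀.1 := by
    intro x hx
    have hp : ((1 : ℝ), x) ∈ S := ⟨by simp, hx⟩
    simp only [k, dif_pos hp]
    exact congrArg Subtype.val (h.apply_one ⟨x, hx⟩)
  -- A point reaches the boundary at time `M / ε` and follows the contraction for the remaining
  -- time. The two formulas agree at the moment of arrival since the contraction starts at the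
  -- identity.
  let q : unitInterval × geom (F : Set (Finset V)) → ℝ × (V → ℝ) := fun p =>
    (p.1 - M p.2.1 / ε, P p.1 p.2.1)
  have hq : Continuous q := by
    refine Continuous.prodMk ?_ hPcont
    exact (continuous_subtype_val.comp continuous_fst).sub
      ((hMcont.comp (continuous_subtype_val.comp continuous_snd)).div_const _)
  have hqS : ∀ p, M p.2.1 ≤ p.1 * ε → q p ∈ S := by
    intro p hp
    have h1 : M p.2.1 / ε ≤ p.1 := (div_le_iff₀ hε0).2 hp
    have h2 : 0 ≤ M p.2.1 / ε := div_nonneg (hM0 _ p.2.2) hε0.le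
    exact ⟨⟨by simpa [q] using h1, by have := p.1.2.2; simp only [q]; linarith⟩,
      (hPmem p.1 p.1.2 _ p.2.2).2 hp⟩
  have hHcont : Continuous fun p : unitInterval × geom (F : Set (Finset V)) =>
      if M p.2.1 ≤ p.1 * ε then k (q p) else P p.1 p.2.1 := by
    refine continuous_if_le (hMcont.comp (continuous_subtype_val.comp continuous_snd))
      ((continuous_subtype_val.comp continuous_fst).mul continuous_const)
      (hk.comp hq.continuousOn hqS) hPcont.continuousOn fun p hp => ?_
    have : q p = (0, P p.1 p.2.1) := by
      simp only [q]
      rw [hp, mul_div_cancel_right₀ _ hε0.ne', sub_self]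
    rw [this]
    exact hk0 _ ((hPmem p.1 p.1.2 _ p.2.2).2 hp.le)
  have hHmem : ∀ p : unitInterval × geom (F : Set (Finset V)),
      (if M p.2.1 ≤ p.1 * ε then k (q p) else P p.1 p.2.1) ∈ geom (F : Set (Finset V)) := by
    intro p
    split_ifs with hp
    · exact hsub (hkmem _ (hqS p hp))
    · exact (hPmem p.1 p.1.2 _ p.2.2).1
  have hA : ∀ (t : unitInterval) (x : geom (F : Set (Finset V))),
      x.1 ∈ geom ((F \ B : Finset _) : Set (Finset V)) →
      (if M x.1 ≤ t * ε then k (q (t, x)) else P t x.1) = k (t, x.1) := by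
    intro t x hx
    have h0 := (hmem x.2).1 hx
    have hM : M x.1 = 0 := Finset.sum_eq_zero h0
    rw [if_pos (by rw [hM]; exact mul_nonneg t.2.1 hε0.le)]
    simp only [q, hM, zero_div, sub_zero, hPzero t x.1 t.2.1 h0]
  refine ⟨⟨fun p => ⟨_, hHmem p⟩, hHcont.subtype_mk _⟩, ⟨y₀.1, hsub y₀.2⟩, fun x => ?_,
    fun t x hx => ?_, fun x hx => ?_⟩
  · apply Subtype.ext
    change (if M x.1 ≤ ((0 : unitInterval) : ℝ) * ε then k (q (0, x)) else P _ x.1) = x.1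
    split_ifs with hM
    · have hM' : M x.1 = 0 := le_antisymm (by simpa using hM) (hM0 _ x.2)
      have : q (0, x) = (0, x.1) := by simp [q, hM', hP0 x.1 x.2]
      rw [this]
      refine hk0 _ ?_
      have := (hPmem 0 (by simp) x.1 x.2).2 (by simpa using hM)
      rwa [hP0 x.1 x.2] at this
    · exact hP0 x.1 x.2
  · change (if M x.1 ≤ t * ε then k (q (t, x)) else P t x.1) ∈ _
    rw [hA t x hx]
    exact hkmem _ ⟨t.2, hx⟩
  · apply Subtype.ext
    change (if M x.1 ≤ ((1 : unitInterval) : ℝ) * ε then k (q (1, x)) else P _ x.1) = y₀.1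
    rw [hA 1 x hx]
    exact hk1 _ hx

/-- The sphere maps of the simplices in `B` form a map to a product of spheres. At most one of its
coordinates leaves the base point, so it lands in the wedge; it is injective off the subcomplex left
by removing `B`, and it sends that subcomplex to the base point. -/
theorem nonempty_homotopyEquiv_sphereWedge {F B : Finset (Finset V)}
    (hF : IsRelLowerSet (F : Set (Finset V)) Finset.Nonempty)
    (hFB : IsRelLowerSet ((F \ B : Finset _) : Set (Finset V)) Finset.Nonempty)
    (hB : B ⊆ F) {d : ℕ} (hmax : ∀ s ∈ F, s.card ≤ d + 1) (hBd : ∀ b ∈ B, b.card = d + 1)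
    (hc : ContractibleSpace (geom ((F \ B : Finset _) : Set (Finset V)))) :
    Nonempty (ContinuousMap.HomotopyEquiv (geom (F : Set (Finset V))) (SphereWedge B.card d)) := by
  have hmax' : ∀ b ∈ B, ∀ s ∈ F, b ⊆ s → s = b := fun b hb s hs hbs =>
    (Finset.eq_of_subset_of_card_le hbs (by rw [hBd b hb]; exact hmax s hs)).symm
  have hmem := fun {x : V → ℝ} => mem_geom_sdiff_iff hF hFB hB hmax' (x := x)
  obtain ⟨H, x₀, hH0, hHA, hH1⟩ := exists_extend_contraction hF hFB hB hmax hBd hc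
  let b : Fin B.card → Finset V := fun i => (B.equivFin.symm i).1
  have hbB : ∀ i, b i ∈ B := fun i => (B.equivFin.symm i).2
  have hbinj : Function.Injective b :=
    Subtype.val_injective.comp B.equivFin.symm.injective
  have hbsurj : ∀ c ∈ B, ∃ i, b i = c := fun c hc => ⟨B.equivFin ⟨c, hc⟩, by simp [b]⟩
  choose φ hφ0 hφinj hφsurj using fun i =>
    exists_collapse_to_sphere hF hmax (hB (hbB i)) (hBd _ (hbB i))
  set x₀' : ∀ _ : Fin B.card, UnitSphere d := fun _ => sphereBase d with hx₀'
  have hφone : ∀ x i, φ i x ≠ sphereBase d → ∀ j, j ≠ i → φ j x = sphereBase d := by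
    intro x i hi j hji
    by_contra hj
    rw [ne_eq, hφ0] at hi
    rw [hφ0] at hj
    have hxF := (mem_geom_iff hF).1 x.2
    have hi' := (minCoord_nonneg (b i) hxF.1).lt_of_ne' hi
    have hj' := (minCoord_nonneg (b j) hxF.1).lt_of_ne' hj
    refine hji (hbinj ?_)
    rw [← hmax' _ (hbB i) _ hxF.2.2 (subset_vsupp_of_minCoord_pos hi'),
      ← hmax' _ (hbB j) _ hxF.2.2 (subset_vsupp_of_minCoord_pos hj')]
  have hφA : ∀ x : geom (F : Set (Finset V)),
      x.1 ∈ geom ((F \ B : Finset _) : Set (Finset V)) ↔ ∀ i, φ i x = sphereBase d := by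
    intro x
    rw [hmem x.2]
    constructor
    · exact fun h i => (hφ0 i x).2 (h _ (hbB i))
    · intro h c hc
      obtain ⟨i, rfl⟩ := hbsurj c hc
      exact (hφ0 i x).1 (h i)
  have hrange : ∀ x, (fun i => φ i x) ∈ Set.range (wedgeToPi x₀') := by
    intro x
    refine mem_range_wedgeToPi x₀' _ ?_
    by_cases h : ∀ i, φ i x = sphereBase d
    · exact Or.inl h
    · push Not at h
      obtain ⟨i, hi⟩ := h
      exact Or.inr ⟨i, hφone x i hi⟩
  choose f hf using hrange
  have : CompactSpace (SphereWedge B.card d) := compactSpace_wedge _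
  have : CompactSpace (geom (F : Set (Finset V))) := isCompact_iff_compactSpace.1 (isCompact_geom _)
  have hemb : Topology.IsClosedEmbedding (wedgeToPi x₀') :=
    (continuous_wedgeToPi x₀').isClosedEmbedding (wedgeToPi_injective x₀')
  have hfcont : Continuous f := by
    rw [hemb.isEmbedding.continuous_iff]
    -- Continuity into the wedge is tested in the product, where it is coordinatewise.
    have : wedgeToPi x₀' ∘ f = fun x i => φ i x := funext hf
    rw [this]
    exact continuous_pi fun i => (φ i).continuous
  obtain ⟨y⟩ : Nonempty (geom ((F \ B : Finset _) : Set (Finset V))) := inferInstance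
  have hsub : geom ((F \ B : Finset _) : Set (Finset V)) ⊆ geom (F : Set (Finset V)) :=
    geom_mono (by rw [Finset.coe_sdiff]; exact Set.sdiff_subset)
  refine nonempty_homotopyEquiv_of_collapse ⟨f, hfcont⟩ ?_
    {x | x.1 ∈ geom ((F \ B : Finset _) : Set (Finset V))} ?_ (f ⟨y.1, hsub y.2⟩) ?_ H hH0 hHA x₀ hH1
  · intro w
    rcases wedgeToPi_cases x₀' w with hw | ⟨i, z, hz, hw⟩
    · refine ⟨⟨y.1, hsub y.2⟩, wedgeToPi_injective x₀' ?_⟩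
      rw [hw]
      exact (hf _).trans (funext ((hφA ⟨y.1, hsub y.2⟩).1 y.2))
    · obtain ⟨x, rfl⟩ := hφsurj i z hz
      refine ⟨x, wedgeToPi_injective x₀' ?_⟩
      rw [hw]
      refine (hf x).trans (funext fun j => ?_)
      by_cases hj : j = i
      · subst hj
        rw [Function.update_self]
      · rw [Function.update_of_ne hj]
        exact hφone x i hz j hj
  · intro x x' hxx'
    have heq : ∀ i, φ i x = φ i x' := fun i => by
      have := congrArg (fun w => wedgeToPi x₀' w i) (show f x = f x' from hxx')
      simpa only [hf] using this
    by_cases h : ∀ i, φ i x = sphereBase d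
    · exact Or.inr ⟨(hφA x).2 h, (hφA x').2 fun i => (heq i) ▸ h i⟩
    · push Not at h
      obtain ⟨i, hi⟩ := h
      exact Or.inl (hφinj i x x' (heq i) hi)
  · intro x hx
    refine wedgeToPi_injective x₀' ?_
    change wedgeToPi x₀' (f x) = wedgeToPi x₀' (f _)
    rw [hf, hf]
    funext i
    rw [(hφA x).1 hx i, (hφA ⟨y.1, hsub y.2⟩).1 y.2 i]

end HomotopyExtension

theorem IsIndepFamily.isHomotopyWedgeOfSpheres {V : Type*} [Fintype V] [DecidableEq V]
    {I : Finset (Finset V)} (hI : IsIndepFamily I) {r : ℕ}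
    (hex : ∃ s ∈ I, s.card = r) (hmax : ∀ s ∈ I, s.card ≤ r) :
    ∃ N : ℕ, (N : ℤ) = (-1) ^ r * ∑ s ∈ I, (-1 : ℤ) ^ s.card ∧
      IsHomotopyWedgeOfSpheres (geom ((I.erase ∅ : Finset _) : Set (Finset V))) N ((r : ℤ) - 1) := by
  rcases r with _ | d
  · have hI0 : I = {∅} := by
      ext s
      rw [Finset.mem_singleton]
      exact ⟨fun hs => Finset.card_eq_zero.1 (Nat.le_zero.1 (hmax s hs)), fun h => h ▸ hI.empty_mem⟩
    subst hI0
    -- Rank zero: only the empty set is independent, the realization is empty, and this counts as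
    -- one copy of `S^(-1)`.
    refine ⟨1, by simp, Or.inl ⟨by simp, rfl, ⟨?_⟩⟩⟩
    rintro ⟨x, -, s, hs, -⟩
    simp at hs
  · obtain ⟨B, hBI, hBd, hB⟩ := hI.exists_collapsible_sdiff d.succ_ne_zero hex hmax
    refine ⟨B.card, hI.card_eq_of_collapsible_sdiff d.succ_ne_zero hBI hBd hB,
      Or.inr ⟨d, by simp, ?_⟩⟩
    refine nonempty_homotopyEquiv_sphereWedge hI.isRelLowerSet hB.isRelLowerSet ?_
      (fun s hs => hmax s (Finset.mem_of_mem_erase hs)) hBd hB.contractibleSpace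
    exact fun s hs => Finset.mem_erase.2 ⟨fun h => by have := hBd s hs; simp [h] at this, hBI hs⟩

/-! ### Counting independent sets by cardinality. -/

section Counting

/-- Double counting of pairs `s ⊆ t` with `k` and `k + 1` elements: `t` has `k + 1` such subsets,
all independent, and `s` has `g` such extensions. -/
theorem IsIndepFamily.succ_mul_card_filter_card_eq {V : Type*} [Fintype V] [DecidableEq V]
    {I : Finset (Finset V)} (hI : IsIndepFamily I) {k g : ℕ}
    (hg : ∀ s ∈ I, s.card = k → (Finset.univ.filter fun x => x ∉ s ∧ insert x s ∈ I).card = g) :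
    (k + 1) * (I.filter fun s => s.card = k + 1).card = (I.filter fun s => s.card = k).card * g := by
  have h := Finset.sum_card_bipartiteAbove_eq_sum_card_bipartiteBelow
    (s := I.filter fun s => s.card = k) (t := I.filter fun s => s.card = k + 1)
    (fun s t : Finset V => s ⊆ t)
  have h1 : ∀ s ∈ I.filter fun s => s.card = k, (Finset.bipartiteAbove (fun s t : Finset V => s ⊆ t)
      (I.filter fun s => s.card = k + 1) s).card = g := by
    intro s hs
    rw [Finset.mem_filter] at hs
    rw [← hg s hs.1 hs.2]
    symm
    refine Finset.card_bij (fun x _ => insert x s) ?_ ?_ ?_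
    · intro x hx
      rw [Finset.mem_filter] at hx
      rw [Finset.mem_bipartiteAbove, Finset.mem_filter, Finset.card_insert_of_notMem hx.2.1, hs.2]
      exact ⟨⟨hx.2.2, rfl⟩, Finset.subset_insert _ _⟩
    · intro x hx y hy hxy
      rw [Finset.mem_filter] at hx hy
      have : x ∈ insert y s := hxy ▸ Finset.mem_insert_self x s
      exact (Finset.mem_insert.1 this).resolve_right hx.2.1
    · intro t ht
      rw [Finset.mem_bipartiteAbove, Finset.mem_filter] at ht
      obtain ⟨x, hx, rfl⟩ := Finset.exists_eq_insert_iff.2 ⟨ht.2, by rw [hs.2, ht.1.2]⟩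
      exact ⟨x, Finset.mem_filter.2 ⟨Finset.mem_univ _, hx, ht.1.1⟩, rfl⟩
  have h2 : ∀ t ∈ I.filter fun s => s.card = k + 1,
      (Finset.bipartiteBelow (fun s t : Finset V => s ⊆ t) (I.filter fun s => s.card = k) t).card
        = k + 1 := by
    intro t ht
    rw [Finset.mem_filter] at ht
    have : Finset.bipartiteBelow (fun s t : Finset V => s ⊆ t) (I.filter fun s => s.card = k) t =
        t.powersetCard k := by
      ext s
      rw [Finset.mem_bipartiteBelow, Finset.mem_filter, Finset.mem_powersetCard]
      exact ⟨fun h => ⟨h.2, h.1.2⟩, fun h => ⟨⟨hI.subset_mem ht.1 h.1, h.2⟩, h.1⟩⟩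
    rw [this, Finset.card_powersetCard, ht.2, Nat.choose_succ_self_right]
  rw [Finset.sum_congr rfl h1, Finset.sum_congr rfl h2, Finset.sum_const, Finset.sum_const,
    smul_eq_mul, smul_eq_mul] at h
  rw [h, mul_comm]

theorem sum_neg_one_pow_card_eq {V : Type*} {I : Finset (Finset V)} {r : ℕ}
    (hmax : ∀ s ∈ I, s.card ≤ r) :
    ∑ s ∈ I, (-1 : ℤ) ^ s.card =
      ∑ k ∈ Finset.range (r + 1), (-1 : ℤ) ^ k * (I.filter fun s => s.card = k).card := by
  rw [← Finset.sum_fiberwise_of_maps_to (t := Finset.range (r + 1)) (g := Finset.card)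
    (fun s hs => Finset.mem_range.2 (Nat.lt_succ_of_le (hmax s hs)))]
  refine Finset.sum_congr rfl fun k _ => ?_
  rw [Finset.sum_congr rfl fun s hs => by rw [(Finset.mem_filter.1 hs).2], Finset.sum_const,
    nsmul_eq_mul, mul_comm]

end Counting

/-! ### The matroid of an indexed family of lines. -/

section LineArrangement

variable {k E V : Type*} [Field k] [AddCommGroup E] [Module k E]

/-- The members of `s` index lines which span a subspace whose dimension is the cardinality
of `s`. -/
def IndepLines (L : V → Submodule k E) (s : Finset V) : Prop :=
  (∀ v ∈ s, Module.finrank k (L v) = 1) ∧ Module.finrank k (s.sup L : Submodule k E) = s.card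

variable [FiniteDimensional k E] {L : V → Submodule k E}

theorem finrank_sup_le_card [DecidableEq V] (s : Finset V)
    (hs : ∀ v ∈ s, Module.finrank k (L v) = 1) :
    Module.finrank k (s.sup L : Submodule k E) ≤ s.card := by
  induction s using Finset.induction_on with
  | empty => simp
  | insert a s ha ih =>
    rw [Finset.sup_insert, Finset.card_insert_of_notMem ha]
    have h1 := Submodule.finrank_add_le_finrank_add_finrank (L a) (s.sup L)
    have h2 := ih (fun l hl => hs l (Finset.mem_insert_of_mem hl))
    have h3 := hs a (Finset.mem_insert_self _ _)
    omega

theorem IndepLines.subset [DecidableEq V] {s t : Finset V} (hs : IndepLines L s) (h : t ⊆ s) :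
    IndepLines L t := by
  have h1 := finrank_sup_le_card t (fun v hv => hs.1 v (h hv))
  have h2 := finrank_sup_le_card (s \ t) (fun v hv => hs.1 v (Finset.sdiff_subset hv))
  have h3 := Submodule.finrank_add_le_finrank_add_finrank (t.sup L) ((s \ t).sup L)
  rw [← Finset.sup_union, Finset.union_sdiff_of_subset h, hs.2] at h3
  have h4 := Finset.card_sdiff_add_card_eq_card h
  exact ⟨fun v hv => hs.1 v (h hv), by omega⟩

/-- A line not contained in a subspace meets it in zero, so adding it raises the dimension by
exactly one. -/
theorem IndepLines.insert_iff [DecidableEq V] {s : Finset V} (hs : IndepLines L s) (x : V) :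
    (x ∉ s ∧ IndepLines L (insert x s)) ↔ (Module.finrank k (L x) = 1 ∧ ¬ L x ≤ s.sup L) := by
  constructor
  · rintro ⟨hx, h1, h2⟩
    refine ⟨h1 x (Finset.mem_insert_self _ _), fun hle => ?_⟩
    rw [Finset.sup_insert, sup_eq_right.2 hle, hs.2, Finset.card_insert_of_notMem hx] at h2
    omega
  · rintro ⟨h1, hle⟩
    have hx : x ∉ s := fun hx => hle (Finset.le_sup hx)
    refine ⟨hx, fun v hv => ?_, ?_⟩
    · rcases Finset.mem_insert.1 hv with rfl | hv
      · exact h1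
      · exact hs.1 v hv
    · have hlt : L x ⊓ s.sup L < L x := inf_lt_left.2 hle
      have h3 := Submodule.finrank_lt_finrank_of_lt hlt
      have h4 := Submodule.finrank_sup_add_finrank_inf_eq (L x) (s.sup L)
      rw [Finset.sup_insert, Finset.card_insert_of_notMem hx]
      have h5 := hs.2
      omega

/-- Common form of all four statements: `L` is `v ↦ span {v}` for vectors and `id` for lines, and `σ
= ∅` gives the whole complex. The number of extensions depends only on the dimension spanned, and
its nonvanishing below the full dimension guarantees independent sets of every cardinality up to the
rank. -/
theorem exists_homotopyWedge_of_indepLines [Fintype V] [DecidableEq V] {g : ℕ → ℚ}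
    (hcount : ∀ W : Submodule k E,
      (Nat.card {x : V // Module.finrank k (L x) = 1 ∧ ¬ L x ≤ W} : ℚ) = g (Module.finrank k W))
    (hg : ∀ j < Module.finrank k E, g j ≠ 0) {n : ℕ} (hn : Module.finrank k E = n)
    {σ : Finset V} (hσ : IndepLines L σ)
    {F : Set (Finset V)}
    (hF : ∀ τ, τ ∈ F ↔ τ.Nonempty ∧ IndepLines L (σ ∪ τ) ∧ Disjoint σ τ) :
    ∃ N : ℕ, (N : ℚ) = (-1) ^ (n - σ.card) + ∑ i ∈ Finset.range (n - σ.card),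
        (-1) ^ (n - σ.card - 1 - i) *
          ((∏ j ∈ Finset.range (i + 1), g (σ.card + j)) / ((i + 1).factorial : ℚ)) ∧
      IsHomotopyWedgeOfSpheres (geom F) N ((n : ℤ) - σ.card - 1) := by
  classical
  subst hn
  set n := Module.finrank k E with hn
  have hle : ∀ s, IndepLines L s → s.card ≤ n := fun s hs => hs.2 ▸ Submodule.finrank_le _
  have hI₀ : IsIndepFamily (Finset.univ.filter (IndepLines L)) :=
    { empty_mem := by simp [IndepLines]
      subset_mem := by
        intro s t hs hts
        rw [Finset.mem_filter] at hs ⊢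
        exact ⟨Finset.mem_univ _, hs.2.subset hts⟩
      exchange := by
        intro s t hs ht hst
        rw [Finset.mem_filter] at hs ht
        obtain ⟨x, hx, hxs⟩ : ∃ x ∈ t, ¬ L x ≤ s.sup L := by
          by_contra! hcon
          have := Submodule.finrank_mono (Finset.sup_le hcon)
          rw [hs.2.2, ht.2.2] at this
          omega
        have := (hs.2.insert_iff x).2 ⟨ht.2.1 x hx, hxs⟩
        exact ⟨x, hx, this.1, Finset.mem_filter.2 ⟨Finset.mem_univ _, this.2⟩⟩ }
  have hI := hI₀.link (Finset.mem_filter.2 ⟨Finset.mem_univ σ, hσ⟩)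
  set I := (Finset.univ.filter (IndepLines L)).filter
    (fun s => Disjoint σ s ∧ σ ∪ s ∈ Finset.univ.filter (IndepLines L)) with hIdef
  have hmemI : ∀ τ, τ ∈ I ↔ IndepLines L (σ ∪ τ) ∧ Disjoint σ τ := by
    intro τ
    simp only [hIdef, Finset.mem_filter, Finset.mem_univ, true_and]
    exact ⟨fun h => ⟨h.2.2, h.2.1⟩, fun h => ⟨h.1.subset Finset.subset_union_right, h.2, h.1⟩⟩
  have hFI : F = ((I.erase ∅ : Finset _) : Set (Finset V)) := by
    ext τ
    rw [hF, Finset.mem_coe, Finset.mem_erase, hmemI, Finset.nonempty_iff_ne_empty]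
  have hcard : ∀ τ ∈ I, σ.card + τ.card ≤ n := fun τ hτ => by
    rw [hmemI] at hτ
    rw [← Finset.card_union_of_disjoint hτ.2]
    exact hle _ hτ.1
  have hσn : σ.card ≤ n := hle σ hσ
  have hext : ∀ τ ∈ I, ((Finset.univ.filter fun x => x ∉ τ ∧ insert x τ ∈ I).card : ℚ) =
      g (σ.card + τ.card) := by
    intro τ hτ
    rw [hmemI] at hτ
    rw [← Finset.card_union_of_disjoint hτ.2, ← hτ.1.2, ← hcount, Nat.card_eq_fintype_card,
      Fintype.card_subtype]
    congr 2
    ext x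
    simp only [Finset.mem_filter, Finset.mem_univ, true_and]
    rw [← hτ.1.insert_iff, hmemI, Finset.union_insert, Finset.disjoint_insert_right,
      Finset.mem_union]
    have := hτ.2
    tauto
  have hf : ∀ m, m ≤ n - σ.card → ((I.filter fun s => s.card = m).card : ℚ) =
      (∏ j ∈ Finset.range m, g (σ.card + j)) / (m.factorial : ℚ) := by
    intro m
    induction m with
    | zero =>
      intro _
      have : (I.filter fun s => s.card = 0) = {∅} := by
        ext s
        simp only [Finset.mem_filter, Finset.card_eq_zero, Finset.mem_singleton]
        exact ⟨fun h => h.2, fun h => ⟨h ▸ hI.empty_mem, h⟩⟩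
      rw [this]
      simp
    | succ m ih =>
      intro hm
      have ihm := ih (by omega)
      -- The rational number `g` is realized as a natural number of extensions only by an actual
      -- independent set, which the nonzero count supplies.
      obtain ⟨τ, hτ⟩ : (I.filter fun s => s.card = m).Nonempty := by
        rw [← Finset.card_pos, ← Nat.cast_pos (α := ℚ), (Nat.cast_nonneg _).lt_iff_ne', ihm]
        refine div_ne_zero (Finset.prod_ne_zero_iff.2 fun j hj => hg _ ?_)
          (Nat.cast_ne_zero.2 (Nat.factorial_ne_zero m))
        rw [Finset.mem_range] at hj
        omega
      rw [Finset.mem_filter] at hτ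
      have hrec := hI.succ_mul_card_filter_card_eq (k := m)
        (g := (Finset.univ.filter fun x => x ∉ τ ∧ insert x τ ∈ I).card) (by
          intro s hs hsm
          rw [← Nat.cast_inj (R := ℚ), hext s hs, hext τ hτ.1, hsm, hτ.2])
      rw [← Nat.cast_inj (R := ℚ)] at hrec
      push_cast at hrec
      rw [hext τ hτ.1, hτ.2, ihm] at hrec
      rw [Finset.prod_range_succ, Nat.factorial_succ]
      have h1 : ((m : ℚ) + 1) ≠ 0 := by positivity
      have h2 : (m.factorial : ℚ) ≠ 0 := Nat.cast_ne_zero.2 (Nat.factorial_ne_zero m)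
      push_cast
      field_simp at hrec ⊢
      linear_combination hrec
  have hex : ∃ s ∈ I, s.card = n - σ.card := by
    obtain ⟨τ, hτ⟩ : (I.filter fun s => s.card = n - σ.card).Nonempty := by
      rw [← Finset.card_pos, ← Nat.cast_pos (α := ℚ), (Nat.cast_nonneg _).lt_iff_ne', hf _ le_rfl]
      refine div_ne_zero (Finset.prod_ne_zero_iff.2 fun j hj => hg _ ?_)
        (Nat.cast_ne_zero.2 (Nat.factorial_ne_zero _))
      rw [Finset.mem_range] at hj
      omega
    exact ⟨τ, (Finset.mem_filter.1 hτ).1, (Finset.mem_filter.1 hτ).2⟩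
  have hmax : ∀ s ∈ I, s.card ≤ n - σ.card := fun s hs => by
    have := hcard s hs
    omega
  obtain ⟨N, hN, hw⟩ := hI.isHomotopyWedgeOfSpheres hex hmax
  refine ⟨N, ?_, ?_⟩
  · rw [sum_neg_one_pow_card_eq hmax, ← Int.cast_inj (α := ℚ)] at hN
    push_cast at hN
    -- The term split off belongs to the empty set and gives the leading sign.
    rw [hN, Finset.sum_range_succ', hf 0 (Nat.zero_le _), add_comm, mul_add, Finset.mul_sum]
    congr 1
    · simp
    · refine Finset.sum_congr rfl fun i hi => ?_
      rw [Finset.mem_range] at hi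
      rw [hf _ hi, ← mul_assoc, ← pow_add]
      congr 1
      -- The two exponents of `-1` have the same parity.
      have : n - σ.card + (i + 1) = n - σ.card - 1 - i + 2 * (i + 1) := by omega
      rw [this, pow_add, pow_mul]
      simp
  · rw [hFI]
    rwa [Nat.cast_sub hσn] at hw

end LineArrangement

/-! ### Counting vectors and lines outside a subspace over a finite field. -/

section FiniteField

variable {k E : Type*} [Field k] [Fintype k] [AddCommGroup E] [Module k E] [Fintype E]

theorem card_notMem_submodule (W : Submodule k E) :
    (Nat.card {x : E // x ∉ W} : ℚ) =
      (Fintype.card k : ℚ) ^ Module.finrank k E - (Fintype.card k : ℚ) ^ Module.finrank k W := by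
  classical
  have h1 : Fintype.card {x : E // x ∉ W} = Fintype.card E - Fintype.card W :=
    Fintype.card_subtype_compl (· ∈ W)
  have h2 : Fintype.card W ≤ Fintype.card E := Fintype.card_subtype_le _
  rw [Nat.card_eq_fintype_card, h1, Nat.cast_sub h2, Module.card_eq_pow_finrank (K := k) (V := E),
    Module.card_eq_pow_finrank (K := k) (V := W)]
  push_cast
  rfl

theorem card_vectors_span_not_le (W : Submodule k E) :
    (Nat.card {x : E // Module.finrank k (Submodule.span k {x}) = 1 ∧
      ¬ Submodule.span k {x} ≤ W} : ℚ) =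
      (Fintype.card k : ℚ) ^ Module.finrank k E - (Fintype.card k : ℚ) ^ Module.finrank k W := by
  rw [← card_notMem_submodule]
  congr 1
  refine Nat.card_congr (Equiv.subtypeEquivRight fun x => ?_)
  rw [Submodule.span_singleton_le_iff_mem]
  refine ⟨fun h => h.2, fun h => ⟨finrank_span_singleton ?_, h⟩⟩
  rintro rfl
  exact h W.zero_mem

/-- The vectors outside `W` are sorted by the line they span: a line not inside `W` meets it in
zero, so each of its `q - 1` nonzero vectors lies outside `W`. -/
theorem card_lines_not_le (W : Submodule k E) :
    (Nat.card {l : Submodule k E // Module.finrank k l = 1 ∧ ¬ l ≤ W} : ℚ) =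
      ((Fintype.card k : ℚ) ^ Module.finrank k E - (Fintype.card k : ℚ) ^ Module.finrank k W) /
        ((Fintype.card k : ℚ) - 1) := by
  classical
  have := Fintype.ofFinite (Submodule k E)
  have hk : 1 < Fintype.card k := Fintype.one_lt_card
  have hk' : (Fintype.card k : ℚ) - 1 ≠ 0 := by
    have : (1 : ℚ) < Fintype.card k := by exact_mod_cast hk
    linarith
  rw [eq_div_iff hk', ← card_notMem_submodule, Nat.card_eq_fintype_card, Nat.card_eq_fintype_card,
    Fintype.card_subtype, Fintype.card_subtype,
    Finset.card_eq_sum_card_fiberwise (f := fun x : E => Submodule.span k {x})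
      (t := Finset.univ.filter fun l : Submodule k E => Module.finrank k l = 1 ∧ ¬ l ≤ W)]
  · have hfib : ∀ l ∈ Finset.univ.filter fun l : Submodule k E => Module.finrank k l = 1 ∧ ¬ l ≤ W,
        ((Finset.univ.filter fun x : E => x ∉ W).filter fun x => Submodule.span k {x} = l).card =
          Fintype.card k - 1 := by
      intro l hl
      simp only [Finset.mem_filter, Finset.mem_univ, true_and] at hl
      have hspan : ∀ x ∈ l, x ≠ 0 → Submodule.span k {x} = l := fun x hx hx0 =>
        Submodule.eq_of_le_of_finrank_eq ((Submodule.span_singleton_le_iff_mem _ _).2 hx)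
          (by rw [finrank_span_singleton hx0, hl.1])
      have heq : ((Finset.univ.filter fun x : E => x ∉ W).filter
          fun x => Submodule.span k {x} = l) = (Finset.univ.filter fun x : E => x ∈ l).erase 0 := by
        ext x
        simp only [Finset.mem_filter, Finset.mem_univ, true_and, Finset.mem_erase]
        constructor
        · rintro ⟨h1, rfl⟩
          exact ⟨fun h => h1 (h ▸ W.zero_mem), Submodule.mem_span_singleton_self x⟩
        · rintro ⟨h1, h2⟩
          refine ⟨fun h => hl.2 ?_, hspan x h2 h1⟩
          rw [← hspan x h2 h1]
          exact (Submodule.span_singleton_le_iff_mem _ _).2 h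
      have hcard : (Finset.univ.filter fun x : E => x ∈ l).card = Fintype.card k := by
        rw [← Fintype.card_subtype]
        exact (Module.card_eq_pow_finrank (K := k) (V := l)).trans (by rw [hl.1, pow_one])
      rw [heq, Finset.card_erase_of_mem (by simp), hcard]
    rw [Finset.sum_congr rfl hfib, Finset.sum_const, smul_eq_mul, Nat.cast_mul,
      Nat.cast_sub hk.le, Nat.cast_one]
  · intro x hx
    simp only [Finset.coe_filter, Finset.mem_univ, true_and, Set.mem_ofPred_eq] at hx ⊢
    refine ⟨finrank_span_singleton fun h => hx (h ▸ W.zero_mem), fun h => hx ?_⟩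
    exact (Submodule.span_singleton_le_iff_mem _ _).1 h

theorem pow_card_sub_pow_ne_zero {j n : ℕ} (h : j < n) :
    (Fintype.card k : ℚ) ^ n - (Fintype.card k : ℚ) ^ j ≠ 0 := by
  have hk : (1 : ℚ) < Fintype.card k := by exact_mod_cast Fintype.one_lt_card (α := k)
  exact (sub_pos.2 (pow_lt_pow_right₀ hk h)).ne'

end FiniteField

/-! ### The complexes `X` and `K` and their links. -/

section Complexes

variable {k : Type*} [Field k] {n : ℕ}

theorem mem_complexX_faces_iff (s : Finset (Fin n → k)) :
    s ∈ (complexX k n).faces ↔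
      s.Nonempty ∧ IndepLines (fun v => Submodule.span k {v}) s := by
  refine and_congr_right fun _ => ?_
  have hsup : s.sup (fun v => Submodule.span k {v}) = Submodule.span k (s : Set (Fin n → k)) := by
    rw [Finset.sup_eq_iSup, Submodule.span_eq_iSup_of_singleton_spans]
    rfl
  constructor
  · intro h
    refine ⟨fun v hv => finrank_span_singleton ?_, by rw [hsup]; exact h.2⟩
    rw [isUnimodularSet_iff_linearIndependent] at h
    exact h.ne_zero ⟨v, hv⟩
  · exact fun h => ⟨exists_isCompl _, hsup ▸ h.2⟩

theorem mem_complexK_faces_iff (s : Finset (Submodule k (Fin n → k))) :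
    s ∈ (complexK k n).faces ↔ s.Nonempty ∧ IndepLines id s :=
  and_congr_right fun _ => ⟨fun h => ⟨fun l hl => (h.1 l hl).2, h.2.2⟩,
    fun h => ⟨fun l hl => ⟨exists_isCompl _, h.1 l hl⟩, exists_isCompl _, h.2⟩⟩

variable {V : Type*} [Finite V] {L : V → Submodule k (Fin n → k)}
  {K : PreAbstractSimplicialComplex V} {g : ℕ → ℚ}

theorem exists_homotopyWedge_realization
    (hK : ∀ s, s ∈ K.faces ↔ s.Nonempty ∧ IndepLines L s)
    (hcount : ∀ W : Submodule k (Fin n → k),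
      (Nat.card {x : V // Module.finrank k (L x) = 1 ∧ ¬ L x ≤ W} : ℚ) = g (Module.finrank k W))
    (hg : ∀ j < n, g j ≠ 0) :
    ∃ N : ℕ, (N : ℚ) = (-1) ^ n + ∑ i ∈ Finset.range n, (-1) ^ (n - 1 - i) *
        ((∏ j ∈ Finset.range (i + 1), g j) / ((i + 1).factorial : ℚ)) ∧
      IsHomotopyWedgeOfSpheres (realization K) N ((n : ℤ) - 1) := by
  classical
  have := Fintype.ofFinite V
  have hE : Module.finrank k (Fin n → k) = n := by simp
  rw [realization_eq_geom]
  -- The whole complex is treated as the link of the empty set.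
  simpa using exists_homotopyWedge_of_indepLines hcount (by rwa [hE]) hE (σ := ∅)
    (by simp [IndepLines]) (F := K.faces) (by simpa using hK)

theorem exists_homotopyWedge_realization_link
    (hK : ∀ s, s ∈ K.faces ↔ s.Nonempty ∧ IndepLines L s)
    (hcount : ∀ W : Submodule k (Fin n → k),
      (Nat.card {x : V // Module.finrank k (L x) = 1 ∧ ¬ L x ≤ W} : ℚ) = g (Module.finrank k W))
    (hg : ∀ j < n, g j ≠ 0) {i : ℕ} {σ : Finset V} (hσ : σ ∈ K.faces) (hσi : σ.card = i + 1) :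
    ∃ N : ℕ, (N : ℚ) = (-1) ^ (n - i - 1) + ∑ m ∈ Finset.range (n - i - 1),
        (-1) ^ (n - i - 2 - m) *
          ((∏ j ∈ Finset.range (m + 1), g (i + 1 + j)) / ((m + 1).factorial : ℚ)) ∧
      IsHomotopyWedgeOfSpheres (realization (simplicialLink K σ)) N ((n : ℤ) - i - 2) := by
  classical
  have := Fintype.ofFinite V
  have hE : Module.finrank k (Fin n → k) = n := by simp
  obtain ⟨N, hN, hw⟩ := exists_homotopyWedge_of_indepLines hcount (by rwa [hE]) hE
    ((hK σ).1 hσ).2 (F := (simplicialLink K σ).faces) (fun τ => by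
      change (τ.Nonempty ∧ _ ∧ _) ↔ _
      rw [hK]
      exact ⟨fun h => ⟨h.1, h.2.1.2, h.2.2⟩,
        fun h => ⟨h.1, ⟨h.1.mono Finset.subset_union_right, h.2.1⟩, h.2.2⟩⟩)
  refine ⟨N, ?_, ?_⟩
  · rw [hN, hσi]
    rfl
  · rw [hσi] at hw
    have : (n : ℤ) - i - 2 = (n : ℤ) - ((i + 1 : ℕ) : ℤ) - 1 := by push_cast; ring
    rw [this]
    exact hw

end Complexes

theorem mainTheorem1 (p : ℕ) [Fact p.Prime] (n : ℕ) :
    (∃ N : ℕ, (N : ℚ) = numA n p ∧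
      IsHomotopyWedgeOfSpheres (realization (complexK (ZMod p) n)) N ((n : ℤ) - 1)) ∧
    (∀ (i : ℕ) (σ : Finset (Submodule (ZMod p) (Fin n → ZMod p))),
      σ ∈ (complexK (ZMod p) n).faces → σ.card = i + 1 →
      ∃ N : ℕ, (N : ℚ) = numALink i n p ∧
        IsHomotopyWedgeOfSpheres (realization (simplicialLink (complexK (ZMod p) n) σ)) N
          ((n : ℤ) - i - 2)) ∧
    (∃ N : ℕ, (N : ℚ) = numB n p ∧
      IsHomotopyWedgeOfSpheres (realization (complexX (ZMod p) n)) N ((n : ℤ) - 1)) ∧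
    (∀ (i : ℕ) (σ : Finset (Fin n → ZMod p)),
      σ ∈ (complexX (ZMod p) n).faces → σ.card = i + 1 →
      ∃ N : ℕ, (N : ℚ) = numBLink i n p ∧
        IsHomotopyWedgeOfSpheres (realization (simplicialLink (complexX (ZMod p) n) σ)) N
          ((n : ℤ) - i - 2)) := by
  have hX : ∀ W : Submodule (ZMod p) (Fin n → ZMod p), _ := fun W => card_vectors_span_not_le W
  have hL : ∀ W : Submodule (ZMod p) (Fin n → ZMod p), _ := fun W => card_lines_not_le W
  simp only [ZMod.card, Module.finrank_fintype_fun_eq_card, Fintype.card_fin] at hX hL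
  have hg : ∀ j < n, (p : ℚ) ^ n - (p : ℚ) ^ j ≠ 0 := fun j hj => by
    simpa only [ZMod.card] using pow_card_sub_pow_ne_zero (k := ZMod p) hj
  have hp : (p : ℚ) - 1 ≠ 0 := by
    have : (1 : ℚ) < p := by exact_mod_cast (Fact.out : p.Prime).one_lt
    linarith
  have hg' : ∀ j < n, ((p : ℚ) ^ n - (p : ℚ) ^ j) / ((p : ℚ) - 1) ≠ 0 := fun j hj =>
    div_ne_zero (hg j hj) hp
  refine ⟨?_, fun i σ hσ hi => ?_, ?_, fun i σ hσ hi => ?_⟩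
  · obtain ⟨N, hN, hw⟩ := exists_homotopyWedge_realization mem_complexK_faces_iff
      (g := fun j => ((p : ℚ) ^ n - (p : ℚ) ^ j) / ((p : ℚ) - 1)) hL hg'
    refine ⟨N, hN.trans ?_, hw⟩
    simp only [numA, Finset.prod_div_distrib, Finset.prod_const, Finset.card_range, div_div]
  · obtain ⟨N, hN, hw⟩ := exists_homotopyWedge_realization_link mem_complexK_faces_iff
      (g := fun j => ((p : ℚ) ^ n - (p : ℚ) ^ j) / ((p : ℚ) - 1)) hL hg' hσ hi
    refine ⟨N, hN.trans ?_, hw⟩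
    simp only [numALink, Finset.prod_div_distrib, Finset.prod_const, Finset.card_range, div_div]
  · exact exists_homotopyWedge_realization mem_complexX_faces_iff
      (g := fun j => (p : ℚ) ^ n - (p : ℚ) ^ j) hX hg
  · exact exists_homotopyWedge_realization_link mem_complexX_faces_iff
      (g := fun j => (p : ℚ) ^ n - (p : ℚ) ^ j) hX hg hσ hi
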